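/- Let $N,K\in\mathbb N$ and let $M=(M_{x,y}^{a,b})_{x,y=1,\dots,N;\,a,b=1,\dots,K}$ be a family of complex coefficients (a Bell functional), acting on families $P=(P(a,b|x,y))$ of real numbers by $\langle M,P\rangle=\sum_{x,y,a,b}M_{x,y}^{a,b}P(a,b|x,y)$. Let $\mathcal L^{in}$ be the set of incomplete classical distributions $P(a,b|x,y)=\int_\Omega P_\omega(a|x)\,Q_\omega(b|y)\,d\mathbb P(\omega)$, where $(\Omega,\mathbb P)$ is a probability space, $P_\omega(a|x),Q_\omega(b|y)\ge 0$, and $\sum_a P_\omega(a|x)\le 1$, $\sum_b Q_\omega(b|y)\le 1$ for all $x,y,\omega$. Let $\mathcal Q^{in}$ be the set of incomplete quantum distributions $P(a,b|x,y)=\mathrm{tr}\big((E_x^a\otimes F_y^b)\rho\big)$, where $H_1,H_2$ are complex Hilbert spaces, $\rho$ is a density operator on $H_1\otimes H_2$, and $E_x^a\in B(H_1)$, $F_y^b\in B(H_2)$ are positive operators with $\sum_aE_x^a\le 1$ and $\sum_bF_y^b\le 1$ for all $x,y$ (incomplete POVMs). Put $$B_C(M)=\sup_{P\in\mathcal L^{in}}|\langle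 M,P\rangle|,\qquad B_Q(M)=\sup_{P\in\mathcal Q^{in}}|\langle M,P\rangle|,\qquad LV(M)=\frac{B_Q(M)}{B_C(M)}\ \text{ if } B_C(M)\ne 0.$$ Let $X=\ell_1^N(\ell_\infty^K)$ over $\mathbb C$, with its natural operator space structure (the operator space $\ell_1$-sum of $N$ copies of $\ell_\infty^K$), and identify $M$ with $\sum_{x,y,a,b}M_{x,y}^{a,b}(e_x\otimes e_a)\otimes(e_y\otimes e_b)\in X\otimes X$. Let $\|M\|_{X\otimes_{\min}X}=\sup\|(u\otimes v)(M)\|_{B(H_1\otimes H_2)}$, the supremum being over all Hilbert spaces $H_1,H_2$ and all complete contractions $u:X\to B(H_1)$, $v:X\to B(H_2)$, and let $\|M\|_{X\otimes_{\epsilon}X}=\sup\{|(\varphi\otimes\psi)(M)|:\varphi,\psi\in X^*,\ \|\varphi\|,\|\psi\|\le 1\}$. Then: 1. For all $N,K$ and $M$, $$B_Q(M)\le \|M\|_{X\otimes_{\min}X}\le 16\,B_Q(M).$$ 2. There are universal constants $c,C>0$ such that for all $N,K$ and all $M$ with $B_C(M)\neq 0$, $$c\,\frac{\|M\|_{X\otimes_{\min}X}}{\|M\|_{X\otimes_{\epsilon}X}}\le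 LV(M)\le C\,\frac{\|M\|_{X\otimes_{\min}X}}{\|M\|_{X\otimes_{\epsilon}X}}.$$ -/

import Mathlib

open scoped TensorProduct InnerProductSpace

noncomputable section

namespace BellMin

/-! ### Bell functionals, classical and quantum bounds -/

/-- The coefficients `M x y a b` of a linear functional on families `P x y a b`
(= `P(a,b|x,y)`), with inputs `x, y` in `Fin N` and outputs `a, b` in `Fin K`. -/
abbrev BellFunctional (N K : ℕ) := Fin N → Fin N → Fin K → Fin K → ℂ

/-- A family of numbers `P x y a b`, standing for `P(a,b|x,y)`. -/
abbrev Behaviour (N K : ℕ) := Fin N → Fin N → Fin K → Fin K → ℝ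

/-- The pairing `⟨M, P⟩ = ∑ M_{x,y}^{a,b} P(a,b|x,y)`. -/
def pairing {N K : ℕ} (M : BellFunctional N K) (P : Behaviour N K) : ℂ :=
  ∑ x, ∑ y, ∑ a, ∑ b, M x y a b * (P x y a b : ℂ)

/-- Incomplete classical distributions: `P(a,b|x,y) = ∫ p_ω(a|x) q_ω(b|y) dμ(ω)` for a
probability space and subnormalised nonnegative families `p_ω`, `q_ω`. -/
def IsIncompleteClassical {N K : ℕ} (P : Behaviour N K) : Prop :=
  ∃ (Ω : Type) (_ : MeasurableSpace Ω) (μ : MeasureTheory.Measure Ω)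
    (p q : Ω → Fin N → Fin K → ℝ),
    MeasureTheory.IsProbabilityMeasure μ ∧
    (∀ x a, Measurable fun ω => p ω x a) ∧ (∀ y b, Measurable fun ω => q ω y b) ∧
    (∀ ω x a, 0 ≤ p ω x a) ∧ (∀ ω x, ∑ a, p ω x a ≤ 1) ∧
    (∀ ω y b, 0 ≤ q ω y b) ∧ (∀ ω y, ∑ b, q ω y b ≤ 1) ∧
    ∀ x y a b, P x y a b = ∫ ω, p ω x a * q ω y b ∂μ

section Hilbert

variable (H₁ H₂ : Type*) [NormedAddCommGroup H₁] [InnerProductSpace ℂ H₁]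
  [NormedAddCommGroup H₂] [InnerProductSpace ℂ H₂]

/-- The Hilbert space tensor product: the completion of the algebraic tensor product with
respect to `⟪a ⊗ b, c ⊗ d⟫ = ⟪a, c⟫ ⟪b, d⟫`. -/
abbrev HilbertTensor := UniformSpace.Completion (H₁ ⊗[ℂ] H₂)

variable {H₁ H₂}

/-- The bounded operator `S ⊗ T` on the Hilbert space tensor product. -/
def tensorOp (S : H₁ →L[ℂ] H₁) (T : H₂ →L[ℂ] H₂) :
    HilbertTensor H₁ H₂ →L[ℂ] HilbertTensor H₁ H₂ :=
  (TensorProduct.mapL S T).completion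

variable (H₁ H₂)

theorem completion_add' {E : Type*} [NormedAddCommGroup E] [NormedSpace ℂ E] (f g : E →L[ℂ] E) :
    (f + g).completion = f.completion + g.completion := by
  ext x
  induction x using UniformSpace.Completion.induction_on with
  | hp => exact isClosed_eq (f + g).completion.continuous (f.completion + g.completion).continuous
  | ih a => simp [UniformSpace.Completion.coe_add]

theorem completion_smul' {E : Type*} [NormedAddCommGroup E] [NormedSpace ℂ E] (c : ℂ)
    (f : E →L[ℂ] E) : (c • f).completion = c • f.completion := by
  ext x
  induction x using UniformSpace.Completion.induction_on with
  | hp => exact isClosed_eq (c • f).completion.continuous (c • f.completion).continuous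
  | ih a =>
    rw [smul_apply, ContinuousLinearMap.completion_apply_coe,
      ContinuousLinearMap.completion_apply_coe, smul_apply,
      UniformSpace.Completion.coe_smul]

/-- The canonical linear map `B(H₁) ⊗ B(H₂) → B(H₁ ⊗ H₂)` sending `S ⊗ T` to `S ⊗ T`. -/
def tensorOpLin : (H₁ →L[ℂ] H₁) ⊗[ℂ] (H₂ →L[ℂ] H₂) →ₗ[ℂ]
    (HilbertTensor H₁ H₂ →L[ℂ] HilbertTensor H₁ H₂) :=
  TensorProduct.lift (LinearMap.mk₂ ℂ tensorOp
    (fun S S' T => by simp only [tensorOp, TensorProduct.mapL_add_left, completion_add'])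
    (fun c S T => by simp only [tensorOp, TensorProduct.mapL_smul_left, completion_smul'])
    (fun S T T' => by simp only [tensorOp, TensorProduct.mapL_add_right, completion_add'])
    (fun c S T => by simp only [tensorOp, TensorProduct.mapL_smul_right, completion_smul']))

end Hilbert

/-- `T` is of trace class with trace `t`: for every orthonormal (Hilbert) basis the diagonal sum
`∑ ⟪b i, T (b i)⟫` converges (unconditionally) to `t`. -/
def HasTrace {H : Type} [NormedAddCommGroup H] [InnerProductSpace ℂ H]
    (T : H →L[ℂ] H) (t : ℂ) : Prop :=
  ∀ (ι : Type) (b : HilbertBasis ι ℂ H), HasSum (fun i => ⟪b i, T (b i)⟫_ℂ) t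

/-- A density operator: positive with trace one. -/
def IsDensity {H : Type} [NormedAddCommGroup H] [InnerProductSpace ℂ H] [CompleteSpace H]
    (ρ : H →L[ℂ] H) : Prop :=
  0 ≤ ρ ∧ HasTrace ρ 1

/-- A family of incomplete POVMs: `E x a ≥ 0` and `∑ a, E x a ≤ 1` for every `x`. -/
def IsIncompletePOVM {N K : ℕ} {H : Type} [NormedAddCommGroup H] [InnerProductSpace ℂ H]
    [CompleteSpace H] (E : Fin N → Fin K → (H →L[ℂ] H)) : Prop :=
  (∀ x a, 0 ≤ E x a) ∧ ∀ x, ∑ a, E x a ≤ 1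

/-- Incomplete quantum distributions: `P(a,b|x,y) = tr ((E_x^a ⊗ F_y^b) ρ)`. -/
def IsIncompleteQuantum {N K : ℕ} (P : Behaviour N K) : Prop :=
  ∃ (H₁ : Type) (_ : NormedAddCommGroup H₁) (_ : InnerProductSpace ℂ H₁) (_ : CompleteSpace H₁)
    (H₂ : Type) (_ : NormedAddCommGroup H₂) (_ : InnerProductSpace ℂ H₂) (_ : CompleteSpace H₂)
    (E : Fin N → Fin K → (H₁ →L[ℂ] H₁)) (F : Fin N → Fin K → (H₂ →L[ℂ] H₂))
    (ρ : HilbertTensor H₁ H₂ →L[ℂ] HilbertTensor H₁ H₂),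
    IsIncompletePOVM E ∧ IsIncompletePOVM F ∧ IsDensity ρ ∧
    ∀ x y a b, HasTrace (tensorOp (E x a) (F y b) ∘L ρ) (P x y a b : ℂ)

/-- The classical bound `B_C(M)` (the set is bounded by `∑ ‖M x y a b‖`). -/
def classicalBound {N K : ℕ} (M : BellFunctional N K) : ℝ :=
  sSup {r : ℝ | ∃ P : Behaviour N K, IsIncompleteClassical P ∧ r = ‖pairing M P‖}

/-- The quantum bound `B_Q(M)` (the set is bounded by `∑ ‖M x y a b‖`). -/
def quantumBound {N K : ℕ} (M : BellFunctional N K) : ℝ :=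
  sSup {r : ℝ | ∃ P : Behaviour N K, IsIncompleteQuantum P ∧ r = ‖pairing M P‖}

/-- The largest quantum violation `LV(M) = B_Q(M) / B_C(M)`. -/
def largestViolation {N K : ℕ} (M : BellFunctional N K) : ℝ :=
  quantumBound M / classicalBound M

/-! ### Operator space structures and the minimal tensor norm -/

/-- A sequence of norms on the spaces `M_n(E)`. -/
abbrev MatrixNorms (E : Type*) := (n : ℕ) → Matrix (Fin n) (Fin n) E → ℝ

/-- A matrix of operators on `H` as an operator on `ℓ₂ⁿ(H)`. -/
def blockOp {H : Type*} [NormedAddCommGroup H] [InnerProductSpace ℂ H] {n : ℕ}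
    (T : Matrix (Fin n) (Fin n) (H →L[ℂ] H)) :
    PiLp 2 (fun _ : Fin n => H) →L[ℂ] PiLp 2 (fun _ : Fin n => H) :=
  (PiLp.continuousLinearEquiv 2 ℂ (fun _ : Fin n => H)).symm.toContinuousLinearMap ∘L
    ContinuousLinearMap.pi fun i => ∑ j, T i j ∘L PiLp.proj 2 (fun _ : Fin n => H) j

/-- The operator space structure of `B(H)`: `M_n(B(H)) = B(ℓ₂ⁿ(H))`. -/
def opNorms (H : Type*) [NormedAddCommGroup H] [InnerProductSpace ℂ H] :
    MatrixNorms (H →L[ℂ] H) :=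
  fun _ T => ‖blockOp T‖

/-- The operator space structure of `ℓ_∞^K`: the norm of `∑ A_k ⊗ e_k` in `M_n(ℓ_∞^K)` is
`max_k ‖A_k‖`. -/
def supNorms (K : ℕ) : MatrixNorms (Fin K → ℂ) :=
  fun n A => ⨆ k : Fin K, ‖Matrix.toEuclideanCLM (n := Fin n) (𝕜 := ℂ) (A.map fun f => f k)‖

/-- A linear map with `‖u‖_cb ≤ 1`. -/
def IsCompleteContraction {E F : Type*} [AddCommGroup E] [Module ℂ E] [AddCommGroup F]
    [Module ℂ F] (ν : MatrixNorms E) (ν' : MatrixNorms F) (u : E →ₗ[ℂ] F) : Prop :=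
  ∀ (n : ℕ) (A : Matrix (Fin n) (Fin n) E), ν' n (A.map u) ≤ ν n A

/-- The operator space structure of the `ℓ₁`-sum `ℓ₁^N(E)`: the norm of an element of
`M_n(ℓ₁^N(E))` is the supremum of the norms in `M_n(B(H))` of its images under the maps
`(e_i)_i ↦ ∑ u_i(e_i)`, over all families of complete contractions `u_i : E → B(H)`. -/
def oneSumNorms (N : ℕ) {E : Type*} [AddCommGroup E] [Module ℂ E] (ν : MatrixNorms E) :
    MatrixNorms (PiLp 1 (fun _ : Fin N => E)) :=
  fun n A => sSup {r : ℝ | ∃ (H : Type) (_ : NormedAddCommGroup H) (_ : InnerProductSpace ℂ H)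
    (_ : CompleteSpace H) (u : Fin N → (E →ₗ[ℂ] (H →L[ℂ] H))),
    (∀ i, IsCompleteContraction ν (opNorms H) (u i)) ∧
    r = opNorms H n (A.map fun e => ∑ i, u i (e i))}

/-- The minimal tensor norm: the supremum of the norms of `(u ⊗ v)(z)` in
`B(H₁) ⊗_min B(H₂) ⊆ B(H₁ ⊗ H₂)` over all complete contractions `u : E → B(H₁)` and
`v : F → B(H₂)`. -/
def minNorm {E F : Type*} [AddCommGroup E] [Module ℂ E] [AddCommGroup F] [Module ℂ F]
    (ν : MatrixNorms E) (ν' : MatrixNorms F) (z : E ⊗[ℂ] F) : ℝ :=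
  sSup {r : ℝ | ∃ (H₁ : Type) (_ : NormedAddCommGroup H₁) (_ : InnerProductSpace ℂ H₁)
    (_ : CompleteSpace H₁) (H₂ : Type) (_ : NormedAddCommGroup H₂)
    (_ : InnerProductSpace ℂ H₂) (_ : CompleteSpace H₂)
    (u : E →ₗ[ℂ] (H₁ →L[ℂ] H₁)) (v : F →ₗ[ℂ] (H₂ →L[ℂ] H₂)),
    IsCompleteContraction ν (opNorms H₁) u ∧ IsCompleteContraction ν' (opNorms H₂) v ∧
    r = ‖tensorOpLin H₁ H₂ (TensorProduct.map u v z)‖}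

/-- The injective tensor norm: the supremum of `|(φ ⊗ ψ)(z)|` over the dual unit balls. -/
def epsNorm {E F : Type*} [NormedAddCommGroup E] [NormedSpace ℂ E] [NormedAddCommGroup F]
    [NormedSpace ℂ F] (z : E ⊗[ℂ] F) : ℝ :=
  sSup {r : ℝ | ∃ (φ : E →L[ℂ] ℂ) (ψ : F →L[ℂ] ℂ), ‖φ‖ ≤ 1 ∧ ‖ψ‖ ≤ 1 ∧
    r = ‖TensorProduct.lid ℂ ℂ (TensorProduct.map φ.toLinearMap ψ.toLinearMap z)‖}

/-! ### The space `ℓ₁^N(ℓ_∞^K)` and the tensor of a Bell functional -/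

/-- The Banach space `ℓ₁^N(ℓ_∞^K)`. -/
abbrev L1Linf (N K : ℕ) := PiLp 1 (fun _ : Fin N => (Fin K → ℂ))

/-- The operator space structure of `ℓ₁^N(ℓ_∞^K)`. -/
def l1LinfNorms (N K : ℕ) : MatrixNorms (L1Linf N K) :=
  oneSumNorms N (supNorms K)

/-- The vector `e_x ⊗ e_a` of `ℓ₁^N(ℓ_∞^K)`. -/
def basisVec {N K : ℕ} (x : Fin N) (a : Fin K) : L1Linf N K :=
  WithLp.toLp 1 (Pi.single x (Pi.single a 1))

/-- The tensor `∑ M_{x,y}^{a,b} (e_x ⊗ e_a) ⊗ (e_y ⊗ e_b)`. -/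
def bellTensor {N K : ℕ} (M : BellFunctional N K) : L1Linf N K ⊗[ℂ] L1Linf N K :=
  ∑ x, ∑ y, ∑ a, ∑ b, M x y a b • (basisVec x a ⊗ₜ[ℂ] basisVec y b)

/-- The norm of `M` in `ℓ₁^N(ℓ_∞^K) ⊗_min ℓ₁^N(ℓ_∞^K)`. -/
def bellMinNorm {N K : ℕ} (M : BellFunctional N K) : ℝ :=
  minNorm (l1LinfNorms N K) (l1LinfNorms N K) (bellTensor M)

/-- The norm of `M` in `ℓ₁^N(ℓ_∞^K) ⊗_ε ℓ₁^N(ℓ_∞^K)`. -/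
def bellEpsNorm {N K : ℕ} (M : BellFunctional N K) : ℝ :=
  epsNorm (bellTensor M)

end BellMin

end

/-! Lower half of part 1. A subnormalised family of positive operators `E a` defines a complete
contraction `e_a ↦ E a` on `ℓ_∞^K` (`isCompleteContraction_coeffMap`), and such maps glue over the
`ℓ₁`-sum. Hence every Bell operator built from incomplete POVMs has norm at most `bellMinNorm M`,
and `|tr (T ρ)| ≤ ‖T‖` (`norm_trace_comp_le`) passes this to `quantumBound M`.

Upper half. It suffices to bound `⟪ξ, (u ⊗ v)(M) η⟫` for complete contractions `u`, `v` and `ξ`, `η`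
in the algebraic tensor product. Both vectors live on finite orthonormal families, so `u` and `v`
may be replaced by matrix compressions `U_a`, `V_b`. An off-diagonal dilation in the spirit of
Paulsen and Wittstock (`exists_posSemidef_dilation`) makes `U_a` the corner of positive semidefinite
`R_a` on the doubled space whose sum has identity diagonal blocks. It comes from M. Riesz extension
of positive functionals: complete contractivity says that the Schur pairing with `[[1/K, U_a],
[U_aᴴ, 1/K]]` is nonnegative on accretive families with constant diagonal blocks, and an extension
to all families is represented by the `R_a`. Conjugating `R_a / 2` by `diag(1, i^k)` gives four
incomplete POVMs, and polarisation recovers the corner `U_a` from them with coefficients of modulus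
1/2. Evaluated at `ξ ⊕ η`, the two corners return the original form. The 16 terms, each weighted
1/4, give `4 B_Q (‖ξ‖² + ‖η‖²)`, so the norm is at most `8 B_Q`.

Part 2 also needs `B_C ≤ ‖M‖_ε ≤ 16 B_C`: dual contractions are exactly the coefficient families
with `∑ a, |p x a| ≤ 1` for each `x`, and each splits into four nonnegative families. -/

namespace BellMin

noncomputable section

/-! ### Positive dilation of matrix families and polarisation into POVMs -/

section Dilation

open Matrix
open scoped ComplexOrder

variable {n K : ℕ}

/-- The real-bilinear pairing `Re ∑ G_a(p,q) B_a(p,q)` of two families of matrices. -/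
def schurPairing {ι : Type*} [Fintype ι] (G : Fin K → Matrix ι ι ℂ) :
    (Fin K → Matrix ι ι ℂ) →ₗ[ℝ] ℝ where
  toFun B := (∑ a, ∑ p, ∑ q, G a p q * B a p q).re
  map_add' B C := by
    simp only [Pi.add_apply, Matrix.add_apply, mul_add, Finset.sum_add_distrib, Complex.add_re]
  map_smul' r B := by
    simp only [Pi.smul_apply, Matrix.smul_apply, Complex.re_sum, RingHom.id_apply,
      Finset.mul_sum, smul_eq_mul, Complex.real_smul]
    refine Finset.sum_congr rfl fun a _ => Finset.sum_congr rfl fun p _ =>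
      Finset.sum_congr rfl fun q _ => ?_
    simp
    ring

theorem schurPairing_apply {ι : Type*} [Fintype ι] (G B : Fin K → Matrix ι ι ℂ) :
    schurPairing G B = (∑ a, ∑ p, ∑ q, G a p q * B a p q).re := rfl

/-- The cone of families of matrices with positive semidefinite real part. -/
def accretiveCone (K : ℕ) (ι : Type*) [Fintype ι] : PointedCone ℝ (Fin K → Matrix ι ι ℂ) where
  carrier := {B | ∀ a (v : ι → ℂ), 0 ≤ (star v ⬝ᵥ B a *ᵥ v).re}
  add_mem' {B C} hB hC a v := by
    simpa [Matrix.add_mulVec, dotProduct_add] using add_nonneg (hB a v) (hC a v)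
  zero_mem' a v := by simp
  smul_mem' r B hB a v := by
    have : (r • B) a *ᵥ v = ((r : ℝ) : ℂ) • (B a *ᵥ v) := by
      rw [← Matrix.smul_mulVec]
      rfl
    rw [this, dotProduct_smul, smul_eq_mul, Complex.re_ofReal_mul]
    exact mul_nonneg r.2 (hB a v)

/-- Families of block matrices whose diagonal blocks do not depend on the index. -/
def constDiagBlocks (K n : ℕ) :
    Submodule ℝ (Fin K → Matrix (Fin n ⊕ Fin n) (Fin n ⊕ Fin n) ℂ) where
  carrier := {B | ∀ a a', (B a).toBlocks₁₁ = (B a').toBlocks₁₁ ∧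
    (B a).toBlocks₂₂ = (B a').toBlocks₂₂}
  add_mem' {B C} hB hC a a' := by
    have h1 := hB a a'
    have h2 := hC a a'
    simp only [← Matrix.ext_iff, toBlocks₁₁, toBlocks₂₂, of_apply, Pi.add_apply,
      Matrix.add_apply] at *
    exact ⟨fun i j => by rw [h1.1, h2.1], fun i j => by rw [h1.2, h2.2]⟩
  zero_mem' a a' := ⟨rfl, rfl⟩
  smul_mem' r B hB a a' := by
    have h1 := hB a a'
    simp only [← Matrix.ext_iff, toBlocks₁₁, toBlocks₂₂, of_apply, Pi.smul_apply,
      Matrix.smul_apply] at *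
    exact ⟨fun i j => by rw [h1.1], fun i j => by rw [h1.2]⟩

theorem re_dotProduct_mulVec_ge {ι : Type*} [Fintype ι] (B : Matrix ι ι ℂ) (v : ι → ℂ) :
    -((∑ p, ∑ q, ‖B p q‖) * ∑ p, ‖v p‖ ^ 2) ≤ (star v ⬝ᵥ B *ᵥ v).re := by
  refine neg_le_of_abs_le ((Complex.abs_re_le_norm _).trans ?_)
  rw [Finset.sum_mul]
  simp only [dotProduct, mulVec, Finset.sum_mul]
  refine (norm_sum_le _ _).trans ?_
  simp only [Finset.mul_sum]
  refine Finset.sum_le_sum fun p _ => (norm_sum_le _ _).trans ?_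
  refine Finset.sum_le_sum fun q _ => ?_
  have hp : ‖v p‖ ^ 2 ≤ ∑ r, ‖v r‖ ^ 2 :=
    Finset.single_le_sum (f := fun r => ‖v r‖ ^ 2) (fun _ _ => by positivity) (Finset.mem_univ p)
  have hq : ‖v q‖ ^ 2 ≤ ∑ r, ‖v r‖ ^ 2 :=
    Finset.single_le_sum (f := fun r => ‖v r‖ ^ 2) (fun _ _ => by positivity) (Finset.mem_univ q)
  have : ‖v p‖ * ‖v q‖ ≤ ∑ r, ‖v r‖ ^ 2 := by nlinarith [sq_nonneg (‖v p‖ - ‖v q‖)]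
  calc ‖star v p * (B p q * v q)‖ = ‖B p q‖ * (‖v p‖ * ‖v q‖) := by
        simp only [norm_mul, Pi.star_apply, norm_star]; ring
    _ ≤ _ := by
        rw [← Finset.mul_sum]
        exact mul_le_mul_of_nonneg_left this (norm_nonneg _)

theorem star_dotProduct_self {ι : Type*} [Fintype ι] (v : ι → ℂ) :
    star v ⬝ᵥ v = ((∑ p, ‖v p‖ ^ 2 : ℝ) : ℂ) := by
  simp only [dotProduct, Pi.star_apply, Complex.ofReal_sum]
  refine Finset.sum_congr rfl fun p _ => ?_
  rw [RCLike.star_def, Complex.conj_mul']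
  simp

/-- The identity family is an order unit for the cone, which supplies the cofinality hypothesis of
the Riesz extension theorem. -/
theorem exists_smul_one_add_mem_accretiveCone {ι : Type*} [Fintype ι] [DecidableEq ι]
    (B : Fin K → Matrix ι ι ℂ) :
    ∃ c : ℝ, (c • (fun _ => 1 : Fin K → Matrix ι ι ℂ)) + B ∈ accretiveCone K ι := by
  refine ⟨∑ a, ∑ p, ∑ q, ‖B a p q‖, fun a v => ?_⟩
  have h := re_dotProduct_mulVec_ge (B a) v
  have ha : ∑ p, ∑ q, ‖B a p q‖ ≤ ∑ a, ∑ p, ∑ q, ‖B a p q‖ :=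
    Finset.single_le_sum (f := fun a => ∑ p, ∑ q, ‖B a p q‖) (fun _ _ => by positivity)
      (Finset.mem_univ a)
  set c := ∑ a, ∑ p, ∑ q, ‖B a p q‖
  have e : ((c • (fun _ => 1 : Fin K → Matrix ι ι ℂ)) + B) a *ᵥ v = (c : ℂ) • v + B a *ᵥ v := by
    rw [Pi.add_apply, Matrix.add_mulVec]
    congr 1
    simp [Matrix.smul_mulVec]
  rw [e, dotProduct_add, dotProduct_smul, star_dotProduct_self, smul_eq_mul, ← Complex.ofReal_mul,
    Complex.add_re, Complex.ofReal_re]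
  have : (∑ p, ∑ q, ‖B a p q‖) * ∑ p, ‖v p‖ ^ 2 ≤ c * ∑ p, ‖v p‖ ^ 2 :=
    mul_le_mul_of_nonneg_right ha (by positivity)
  linarith

/-- A positive semidefinite block matrix with invertible diagonal blocks `Sᴴ S` and `Tᴴ T` has
off-diagonal block `Sᴴ A T` with `A` a contraction. -/
theorem exists_contraction_of_posSemidef_fromBlocks {S T Z : Matrix (Fin n) (Fin n) ℂ}
    (hS : IsUnit S) (hT : IsUnit T)
    (h : (fromBlocks (Sᴴ * S) Z Zᴴ (Tᴴ * T)).PosSemidef) :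
    ∃ A : Matrix (Fin n) (Fin n) ℂ,
      ‖toEuclideanCLM (n := Fin n) (𝕜 := ℂ) A‖ ≤ 1 ∧ Z = Sᴴ * A * T := by
  have hSd := (Matrix.isUnit_iff_isUnit_det _).1 hS
  have hTd := (Matrix.isUnit_iff_isUnit_det _).1 hT
  have hSd' : IsUnit (Sᴴ).det := by rw [det_conjTranspose]; exact hSd.star
  have hTd' : IsUnit (Tᴴ).det := by rw [det_conjTranspose]; exact hTd.star
  have hX : (Sᴴ * S).PosDef := Matrix.PosDef.conjTranspose_mul_self S
    (Matrix.mulVec_injective_of_isUnit hS)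
  have : Invertible (Sᴴ * S) := hX.isUnit.invertible
  rw [Matrix.PosDef.fromBlocks₁₁ _ _ hX] at h
  have hA := h.conjTranspose_mul_mul_same T⁻¹
  refine ⟨(Sᴴ)⁻¹ * Z * T⁻¹, ?_, ?_⟩
  -- The Schur complement, conjugated by `T⁻¹`, is `1 - Aᴴ A`; its positivity is the contractivity
  -- of `A`.
  · have e : (T⁻¹)ᴴ * (Tᴴ * T - Zᴴ * (Sᴴ * S)⁻¹ * Z) * T⁻¹ =
        1 - ((Sᴴ)⁻¹ * Z * T⁻¹)ᴴ * ((Sᴴ)⁻¹ * Z * T⁻¹) := by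
      have h1 : (T⁻¹)ᴴ * (Tᴴ * T) * T⁻¹ = 1 := by
        rw [Matrix.conjTranspose_nonsing_inv, ← Matrix.mul_assoc, Matrix.nonsing_inv_mul _ hTd',
          Matrix.one_mul, Matrix.mul_nonsing_inv _ hTd]
      have h2 : ((Sᴴ)⁻¹ * Z * T⁻¹)ᴴ = (T⁻¹)ᴴ * (Zᴴ * S⁻¹) := by
        rw [Matrix.conjTranspose_mul, Matrix.conjTranspose_mul,
          Matrix.conjTranspose_nonsing_inv Sᴴ, Matrix.conjTranspose_conjTranspose]
      rw [Matrix.mul_sub, Matrix.sub_mul, h1, Matrix.mul_inv_rev, h2]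
      simp only [Matrix.mul_assoc]
    rw [e] at hA
    set A := (Sᴴ)⁻¹ * Z * T⁻¹
    refine ContinuousLinearMap.opNorm_le_bound _ zero_le_one fun v => ?_
    rw [one_mul]
    have hv := hA.dotProduct_mulVec_nonneg (v.ofLp)
    rw [Matrix.sub_mulVec, Matrix.one_mulVec, dotProduct_sub, star_dotProduct_self,
      ← Matrix.mulVec_mulVec, Matrix.dotProduct_mulVec, Matrix.vecMul_conjTranspose, star_star,
      star_dotProduct_self] at hv
    rw [← Complex.ofReal_sub, Complex.zero_le_real, sub_nonneg] at hv
    rw [EuclideanSpace.norm_eq, EuclideanSpace.norm_eq]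
    exact Real.sqrt_le_sqrt hv
  · rw [← Matrix.mul_assoc, ← Matrix.mul_assoc, Matrix.mul_nonsing_inv _ hSd', Matrix.one_mul,
      Matrix.mul_assoc, Matrix.nonsing_inv_mul _ hTd, Matrix.mul_one]

open scoped MatrixOrder in
theorem exists_isUnit_conjTranspose_mul_self {X : Matrix (Fin n) (Fin n) ℂ} (hX : X.PosDef) :
    ∃ S : Matrix (Fin n) (Fin n) ℂ, IsUnit S ∧ X = Sᴴ * S :=
  CStarAlgebra.isStrictlyPositive_iff_eq_star_mul_self.mp hX.isStrictlyPositive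

/-- The block matrix `[[1/K, U_a], [U_aᴴ, 1/K]]`. -/
def dilationKernel (U : Fin K → Matrix (Fin n) (Fin n) ℂ) (a : Fin K) :
    Matrix (Fin n ⊕ Fin n) (Fin n ⊕ Fin n) ℂ :=
  fromBlocks ((K : ℂ)⁻¹ • 1) (U a) (U a)ᴴ ((K : ℂ)⁻¹ • 1)

theorem isHermitian_dilationKernel (U : Fin K → Matrix (Fin n) (Fin n) ℂ) (a : Fin K) :
    (dilationKernel U a).IsHermitian := by
  refine Matrix.IsHermitian.fromBlocks ?_ rfl ?_ <;>
  · rw [Matrix.IsHermitian, Matrix.conjTranspose_smul, Matrix.conjTranspose_one]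
    simp

theorem schurPairing_conjTranspose {ι : Type*} [Fintype ι] {G : Fin K → Matrix ι ι ℂ}
    (hG : ∀ a, (G a).IsHermitian) (B : Fin K → Matrix ι ι ℂ) :
    schurPairing G (fun a => (B a)ᴴ) = schurPairing G B := by
  simp only [schurPairing_apply, Complex.re_sum]
  refine Finset.sum_congr rfl fun a _ => ?_
  rw [Finset.sum_comm]
  refine Finset.sum_congr rfl fun p _ => Finset.sum_congr rfl fun q _ => ?_
  rw [conjTranspose_apply, ← (hG a).apply, ← Complex.conj_re, ← Complex.star_def, star_mul', star_star,
    star_star]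

/-- The trace-dual form of complete contractivity of `e_a ↦ U_a`: the pairing of `U` with every
family `Sᴴ A_a T`, the `A_a` contractions, is at most `(tr Sᴴ S + tr Tᴴ T) / 2`. -/
def IsTestContractive (U : Fin K → Matrix (Fin n) (Fin n) ℂ) : Prop :=
  ∀ A : Fin K → Matrix (Fin n) (Fin n) ℂ,
    (∀ a, ‖toEuclideanCLM (n := Fin n) (𝕜 := ℂ) (A a)‖ ≤ 1) →
    ∀ S T : Matrix (Fin n) (Fin n) ℂ,
      ‖∑ a, ∑ i, ∑ j, U a i j * (Sᴴ * A a * T) i j‖ ≤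
        ((Sᴴ * S).trace.re + (Tᴴ * T).trace.re) / 2

theorem sum_dilationKernel_mul (U : Fin K → Matrix (Fin n) (Fin n) ℂ) (a : Fin K)
    (X Z W Y : Matrix (Fin n) (Fin n) ℂ) :
    ∑ p, ∑ q, dilationKernel U a p q * fromBlocks X Z W Y p q =
      (K : ℂ)⁻¹ * (X.trace + Y.trace) + ∑ i, ∑ j, U a i j * Z i j +
        ∑ i, ∑ j, star (U a i j) * W j i := by
  have h (V : Matrix (Fin n) (Fin n) ℂ) :
      ∑ i, ∑ j, ((K : ℂ)⁻¹ • (1 : Matrix (Fin n) (Fin n) ℂ)) i j * V i j =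
        (K : ℂ)⁻¹ * V.trace := by
    simp [Matrix.trace, Matrix.one_apply, Finset.mul_sum]
  simp only [dilationKernel, Fintype.sum_sum_type, fromBlocks_apply₁₁, fromBlocks_apply₁₂,
    fromBlocks_apply₂₁, fromBlocks_apply₂₂, Finset.sum_add_distrib, h]
  rw [Finset.sum_comm (f := fun i j => star (U a i j) * W j i)]
  simp only [conjTranspose_apply]
  ring

/-- Since the diagonal blocks do not depend on `a`, one pair `S`, `T` factors all of them, and the
corners become `Sᴴ A_a T` with contractions `A_a`. The pairing is then `tr Sᴴ S + tr Tᴴ T` plus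
twice the real part of exactly the sum controlled by `IsTestContractive`. -/
theorem schurPairing_dilationKernel_nonneg_of_posDef [NeZero K]
    {U : Fin K → Matrix (Fin n) (Fin n) ℂ} (hU : IsTestContractive U)
    {B : Fin K → Matrix (Fin n ⊕ Fin n) (Fin n ⊕ Fin n) ℂ} (hB : B ∈ constDiagBlocks K n)
    (hpos : ∀ a, (B a).PosDef) : 0 ≤ schurPairing (dilationKernel U) B := by
  have hX : ((B 0).toBlocks₁₁).PosDef := (hpos 0).submatrix Sum.inl_injective
  have hY : ((B 0).toBlocks₂₂).PosDef := (hpos 0).submatrix Sum.inr_injective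
  obtain ⟨S, hS, hXS⟩ := exists_isUnit_conjTranspose_mul_self hX
  obtain ⟨T, hT, hYT⟩ := exists_isUnit_conjTranspose_mul_self hY
  have hblock a : B a = fromBlocks (Sᴴ * S) (B a).toBlocks₁₂ (B a).toBlocks₁₂ᴴ (Tᴴ * T) := by
    have h21 : (B a).toBlocks₁₂ᴴ = (B a).toBlocks₂₁ := by
      ext i j
      exact (hpos a).isHermitian.apply _ _
    rw [h21, ← hXS, ← hYT, ← (hB a 0).1, ← (hB a 0).2, fromBlocks_toBlocks]
  have hA a := exists_contraction_of_posSemidef_fromBlocks hS hT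
    (hblock a ▸ (hpos a).posSemidef)
  choose A hA1 hA2 using hA
  have hsum : ∑ a, ∑ p, ∑ q, dilationKernel U a p q * B a p q =
      (Sᴴ * S).trace + (Tᴴ * T).trace + (∑ a, ∑ i, ∑ j, U a i j * (Sᴴ * A a * T) i j +
        star (∑ a, ∑ i, ∑ j, U a i j * (Sᴴ * A a * T) i j)) := by
    have h a : ∑ p, ∑ q, dilationKernel U a p q * B a p q =
        (K : ℂ)⁻¹ * ((Sᴴ * S).trace + (Tᴴ * T).trace) +
          ∑ i, ∑ j, U a i j * (Sᴴ * A a * T) i j +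
          ∑ i, ∑ j, star (U a i j * (Sᴴ * A a * T) i j) := by
      rw [hblock a, sum_dilationKernel_mul, hA2 a]
      simp only [conjTranspose_apply, star_mul']
    simp only [h, Finset.sum_add_distrib, star_sum]
    rw [Finset.sum_const, Finset.card_univ, Fintype.card_fin, nsmul_eq_mul, ← mul_assoc,
      mul_inv_cancel₀ (Nat.cast_ne_zero.2 (NeZero.ne K)), one_mul, add_assoc]
  have hle := hU A hA1 S T
  have hre := (Complex.abs_re_le_norm _).trans hle
  rw [schurPairing_apply, hsum]
  simp only [Complex.add_re, Complex.star_def, Complex.conj_re]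
  linarith [neg_le_of_abs_le hre]

theorem one_mem_constDiagBlocks :
    (fun _ => 1 : Fin K → Matrix (Fin n ⊕ Fin n) (Fin n ⊕ Fin n) ℂ) ∈ constDiagBlocks K n :=
  fun _ _ => ⟨rfl, rfl⟩

theorem posDef_add_conjTranspose_add_smul_one {ι : Type*} [Fintype ι] [DecidableEq ι]
    {B : Matrix ι ι ℂ} (hB : ∀ v : ι → ℂ, 0 ≤ (star v ⬝ᵥ B *ᵥ v).re) {ε : ℝ} (hε : 0 < ε) :
    (B + Bᴴ + ε • (1 : Matrix ι ι ℂ)).PosDef := by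
  have h1 : (B + Bᴴ).PosSemidef := by
    refine .of_dotProduct_mulVec_nonneg (isHermitian_add_transpose_self B) fun v => ?_
    have h2 : star v ⬝ᵥ Bᴴ *ᵥ v = star (star v ⬝ᵥ B *ᵥ v) := by
      rw [star_dotProduct, star_mulVec, conjTranspose_conjTranspose, ← dotProduct_mulVec]
    rw [Matrix.add_mulVec, dotProduct_add, h2, Complex.star_def, Complex.add_conj]
    exact_mod_cast mul_nonneg zero_le_two (hB v)
  exact Matrix.PosDef.posSemidef_add h1 (Matrix.PosDef.one.smul hε)

/-- Reduction to the positive definite case through `B + Bᴴ + ε`. The kernel is Hermitian, so `B`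
and `Bᴴ` pair equally, and small `ε` gives the claim. -/
theorem schurPairing_dilationKernel_nonneg [NeZero K]
    {U : Fin K → Matrix (Fin n) (Fin n) ℂ} (hU : IsTestContractive U)
    {B : Fin K → Matrix (Fin n ⊕ Fin n) (Fin n ⊕ Fin n) ℂ} (hB : B ∈ constDiagBlocks K n)
    (hpos : B ∈ accretiveCone K (Fin n ⊕ Fin n)) : 0 ≤ schurPairing (dilationKernel U) B := by
  set f := schurPairing (dilationKernel U)
  have hB' : (fun a => (B a)ᴴ) ∈ constDiagBlocks K n := fun a a' => by
    constructor
    · have := congrArg conjTranspose (hB a a').1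
      exact this
    · have := congrArg conjTranspose (hB a a').2
      exact this
  have key (ε : ℝ) (hε : 0 < ε) : 0 ≤ f B + f B + ε * f (fun _ => 1) := by
    have h := schurPairing_dilationKernel_nonneg_of_posDef hU
      (add_mem (add_mem hB hB') ((constDiagBlocks K n).smul_mem ε one_mem_constDiagBlocks))
      (fun a => posDef_add_conjTranspose_add_smul_one (hpos a) hε)
    rwa [map_add, map_add, map_smul, schurPairing_conjTranspose (isHermitian_dilationKernel U),
      smul_eq_mul] at h
  by_contra hneg
  push Not at hneg
  rcases le_or_gt (f (fun _ => 1)) 0 with h1 | h1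
  · nlinarith [key 1 one_pos]
  -- This `ε` makes `ε * f 1 = -f B`, so that `key` reads `0 ≤ f B`.
  · have h2 := key (-(f B) / f (fun _ => 1)) (div_pos (neg_pos.2 hneg) h1)
    rw [div_mul_cancel₀ _ h1.ne'] at h2
    linarith

theorem exists_schurPairing_extension [NeZero K]
    {U : Fin K → Matrix (Fin n) (Fin n) ℂ} (hU : IsTestContractive U) :
    ∃ g : (Fin K → Matrix (Fin n ⊕ Fin n) (Fin n ⊕ Fin n) ℂ) →ₗ[ℝ] ℝ,
      (∀ B ∈ constDiagBlocks K n, g B = schurPairing (dilationKernel U) B) ∧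
      ∀ B ∈ accretiveCone K (Fin n ⊕ Fin n), 0 ≤ g B := by
  obtain ⟨g, hg1, hg2⟩ := riesz_extension (accretiveCone K (Fin n ⊕ Fin n))
    ⟨constDiagBlocks K n, (schurPairing (dilationKernel U)).domRestrict _⟩
    (fun B hB => schurPairing_dilationKernel_nonneg hU B.2 hB)
    (fun B => by
      obtain ⟨c, hc⟩ := exists_smul_one_add_mem_accretiveCone B
      exact ⟨⟨_, (constDiagBlocks K n).smul_mem c one_mem_constDiagBlocks⟩, hc⟩)
  exact ⟨g, fun B hB => hg1 ⟨B, hB⟩, hg2⟩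

/-- The family with the matrix `B` at position `a` and zero elsewhere. -/
abbrev singleFamily {ι : Type*} (a : Fin K) (B : Matrix ι ι ℂ) : Fin K → Matrix ι ι ℂ :=
  Pi.single a B

/-- The matrices representing a real functional on families of complex matrices through the
Schur pairing. -/
def schurRepr {ι : Type*} [DecidableEq ι] (g : (Fin K → Matrix ι ι ℂ) →ₗ[ℝ] ℝ) (a : Fin K) :
    Matrix ι ι ℂ :=
  -- If `g` is `z ↦ Re (G z)` on one entry, then `g 1 = Re G` and `g I = -Im G`.
  fun p q => (g (singleFamily a (Matrix.single p q 1)) : ℂ) -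
    (g (singleFamily a (Matrix.single p q Complex.I)) : ℂ) * Complex.I

theorem schurPairing_schurRepr {ι : Type*} [Fintype ι] [DecidableEq ι]
    (g : (Fin K → Matrix ι ι ℂ) →ₗ[ℝ] ℝ) : schurPairing (schurRepr g) = g := by
  refine LinearMap.ext fun B => ?_
  have hB : B = ∑ a, ∑ p, ∑ q, ((B a p q).re • (singleFamily a (Matrix.single p q 1)) +
      (B a p q).im • (singleFamily a (Matrix.single p q Complex.I))) := by
    ext a p q
    simp only [Finset.sum_apply, Matrix.sum_apply, Pi.add_apply, Matrix.add_apply,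
      Pi.smul_apply, Matrix.smul_apply]
    rw [Finset.sum_eq_single a, Finset.sum_eq_single p, Finset.sum_eq_single q]
    · simp
    · intro q' _ hq
      simp [hq]
    · simp
    · intro p' _ hp
      simp [hp]
    · simp
    · intro a' _ ha
      simp [Pi.single_eq_of_ne ha.symm]
    · simp
  conv_rhs => rw [hB]
  simp only [map_sum, map_add, map_smul, schurPairing_apply, Complex.re_sum, schurRepr]
  refine Finset.sum_congr rfl fun a _ => Finset.sum_congr rfl fun p _ =>
      Finset.sum_congr rfl fun q _ => ?_
  simp
  ring

theorem schurPairing_single {ι : Type*} [Fintype ι] (G : Fin K → Matrix ι ι ℂ) (a : Fin K)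
    (B : Matrix ι ι ℂ) :
    schurPairing G (singleFamily a B) = (∑ p, ∑ q, G a p q * B p q).re := by
  rw [schurPairing_apply, Finset.sum_eq_single a]
  · simp
  · intro a' _ ha
    simp [Pi.single_eq_of_ne ha]
  · simp

theorem schurPairing_single_single {ι : Type*} [Fintype ι] [DecidableEq ι]
    (G : Fin K → Matrix ι ι ℂ) (a : Fin K) (p q : ι) (z : ℂ) :
    schurPairing G (singleFamily a (Matrix.single p q z)) = (G a p q * z).re := by
  rw [schurPairing_single, Finset.sum_eq_single p, Finset.sum_eq_single q]
  · simp
  · intro q' _ hq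
    simp [hq.symm]
  · simp
  · intro p' _ hp
    simp [hp.symm]
  · simp

/-- The cone contains both signs of every skew-Hermitian family, so `g` vanishes there; testing on
two-entry skew matrices yields the symmetry. -/
theorem isHermitian_schurRepr {ι : Type*} [Fintype ι] [DecidableEq ι]
    {g : (Fin K → Matrix ι ι ℂ) →ₗ[ℝ] ℝ} (hg : ∀ B ∈ accretiveCone K ι, 0 ≤ g B) (a : Fin K) :
    (schurRepr g a).IsHermitian := by
  have hskew (B : Matrix ι ι ℂ) (hB : ∀ v : ι → ℂ, (star v ⬝ᵥ B *ᵥ v).re = 0) :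
      g (singleFamily a B) = 0 := by
    have hB' (a') (v : ι → ℂ) :
        (star v ⬝ᵥ singleFamily a B a' *ᵥ v).re = 0 := by
      rcases eq_or_ne a' a with rfl | h
      · rw [singleFamily, Pi.single_eq_same, hB]
      · simp [Pi.single_eq_of_ne h]
    refine le_antisymm ?_ (hg _ fun a v => (hB' a v).ge)
    have := hg (-singleFamily a B) fun a v => by
      rw [Pi.neg_apply, Matrix.neg_mulVec, dotProduct_neg, Complex.neg_re, hB', neg_zero]
    rwa [map_neg, neg_nonneg] at this
  have hz (p q : ι) (z : ℂ) :
      (schurRepr g a p q * z).re = (schurRepr g a q p * star z).re := by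
    have h := hskew (Matrix.single p q z - Matrix.single q p (star z)) fun v => by
      rw [Matrix.sub_mulVec, dotProduct_sub]
      have hu (r : ι) (w : ℂ) : Function.update (0 : ι → ℂ) r w = Pi.single r w := rfl
      simp [Matrix.single_mulVec, hu]
      ring
    rw [singleFamily, Pi.single_sub, map_sub, sub_eq_zero, ← schurPairing_schurRepr g,
      schurPairing_single_single, schurPairing_single_single] at h
    exact h
  ext p q
  rw [conjTranspose_apply]
  have h1 := hz p q 1
  have h2 := hz p q Complex.I
  simp at h1 h2
  apply Complex.ext
  · simp [h1]
  · simp [← h2]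

theorem posSemidef_schurRepr {ι : Type*} [Fintype ι] [DecidableEq ι]
    {g : (Fin K → Matrix ι ι ℂ) →ₗ[ℝ] ℝ} (hg : ∀ B ∈ accretiveCone K ι, 0 ≤ g B) (a : Fin K) :
    (schurRepr g a).PosSemidef := by
  refine .of_dotProduct_mulVec_nonneg (isHermitian_schurRepr hg a) fun x => ?_
  rw [Complex.nonneg_iff]
  refine ⟨?_, ((isHermitian_schurRepr hg a).im_star_dotProduct_mulVec_self x).symm⟩
  -- Pairing with this rank-one matrix gives the quadratic form of `schurRepr g a` at `x`.
  have h := hg (singleFamily a (vecMulVec (star x) x)) fun a' v => by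
    rcases eq_or_ne a' a with rfl | h
    · rw [singleFamily, Pi.single_eq_same]
      exact (Complex.nonneg_iff.1
        ((posSemidef_vecMulVec_star_self x).dotProduct_mulVec_nonneg v)).1
    · simp [Pi.single_eq_of_ne h]
  rw [← schurPairing_schurRepr g, schurPairing_single] at h
  convert h using 2
  simp only [dotProduct, mulVec, Finset.mul_sum, vecMulVec_apply]
  refine Finset.sum_congr rfl fun p _ => Finset.sum_congr rfl fun q _ => ?_
  ring

/-- The extension is only known on constant-diagonal families. These include a single entry in an
off-diagonal block at one index `a`, which fixes the corner as `U_a`, and constant families, which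
fix the sums of the diagonal blocks as `K · (1/K) = 1`. -/
theorem exists_posSemidef_dilation [NeZero K]
    {U : Fin K → Matrix (Fin n) (Fin n) ℂ} (hU : IsTestContractive U) :
    ∃ R : Fin K → Matrix (Fin n ⊕ Fin n) (Fin n ⊕ Fin n) ℂ,
      (∀ a, (R a).PosSemidef) ∧ (∀ a, (R a).toBlocks₁₂ = U a) ∧
      (∑ a, R a).toBlocks₁₁ = 1 ∧ (∑ a, R a).toBlocks₂₂ = 1 := by
  obtain ⟨g, hg1, hg2⟩ := exists_schurPairing_extension hU
  have hrepr (a p q) (h : ∀ z, singleFamily a (Matrix.single p q z) ∈ constDiagBlocks K n) :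
      schurRepr g a p q = dilationKernel U a p q := by
    rw [schurRepr, hg1 _ (h 1), hg1 _ (h Complex.I), schurPairing_single_single,
      schurPairing_single_single]
    apply Complex.ext <;> simp
  have hsum (p q) (h : ∀ z : ℂ, (fun _ => Matrix.single p q z) ∈ constDiagBlocks K n) :
      ∑ a, schurRepr g a p q = ∑ a, dilationKernel U a p q := by
    have hc (z : ℂ) : ∑ a, g (singleFamily a (Matrix.single p q z)) =
        ∑ a, (dilationKernel U a p q * z).re := by
      simp only [← schurPairing_single_single]
      rw [← map_sum, ← map_sum, ← hg1]
      exact (Finset.univ_sum_single (fun _ : Fin K => Matrix.single p q z)) ▸ h z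
    simp only [schurRepr]
    rw [Finset.sum_sub_distrib, ← Finset.sum_mul, ← Complex.ofReal_sum, ← Complex.ofReal_sum,
      hc, hc]
    apply Complex.ext <;> simp
  have hK : (K : ℂ) ≠ 0 := Nat.cast_ne_zero.2 (NeZero.ne K)
  refine ⟨schurRepr g, posSemidef_schurRepr hg2, fun a => ?_, ?_, ?_⟩
  · ext i j
    refine (hrepr a _ _ fun z => ?_).trans rfl
    have h0 (a') : (singleFamily a (Matrix.single (Sum.inl i) (Sum.inr j) z) a').toBlocks₁₁ = 0 ∧
        (singleFamily a (Matrix.single (Sum.inl i) (Sum.inr j) z) a').toBlocks₂₂ = 0 := by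
      rcases eq_or_ne a' a with rfl | h
      · rw [singleFamily, Pi.single_eq_same]
        constructor <;> ext <;> simp [toBlocks₁₁, toBlocks₂₂]
      · rw [singleFamily, Pi.single_eq_of_ne h]
        exact ⟨rfl, rfl⟩
    exact fun a₁ a₂ => ⟨(h0 a₁).1.trans (h0 a₂).1.symm, (h0 a₁).2.trans (h0 a₂).2.symm⟩
  · ext i j
    rw [toBlocks₁₁, of_apply, Matrix.sum_apply, hsum _ _ fun z _ _ => ⟨rfl, rfl⟩]
    simp [dilationKernel, hK]
  · ext i j
    rw [toBlocks₂₂, of_apply, Matrix.sum_apply, hsum _ _ fun z _ _ => ⟨rfl, rfl⟩]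
    simp [dilationKernel, hK]

/-- The diagonal unitary `diag(1, z)`. -/
def phaseDiag (n : ℕ) (z : ℂ) : Matrix (Fin n ⊕ Fin n) (Fin n ⊕ Fin n) ℂ :=
  fromBlocks 1 0 0 (z • 1)

theorem phaseDiag_conj (z : ℂ) (X Z W Y : Matrix (Fin n) (Fin n) ℂ) :
    (phaseDiag n z)ᴴ * fromBlocks X Z W Y * phaseDiag n z =
      fromBlocks X (z • Z) (star z • W) ((star z * z) • Y) := by
  simp [phaseDiag, fromBlocks_conjTranspose, fromBlocks_multiply, smul_smul, mul_comm]

/-- Polarisation of a test-contractive family into four incomplete POVMs on the doubled space. -/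
theorem exists_povm_polarization {U : Fin K → Matrix (Fin n) (Fin n) ℂ}
    (hU : IsTestContractive U) :
    ∃ E : Fin 4 → Fin K → Matrix (Fin n ⊕ Fin n) (Fin n ⊕ Fin n) ℂ,
      (∀ k a, (E k a).PosSemidef) ∧ (∀ k, (1 - ∑ a, E k a).PosSemidef) ∧
      ∀ a, fromBlocks 0 (U a) 0 0 = (2 : ℂ)⁻¹ • ∑ k : Fin 4, star (Complex.I ^ (k : ℕ)) • E k a := by
  -- The dilation excludes `K = 0`, where the normalisation `K · (1/K) = 1` fails.
  rcases Nat.eq_zero_or_pos K with rfl | hK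
  · exact ⟨fun _ a => a.elim0, fun _ a => a.elim0, fun _ => by simpa using PosSemidef.one,
      fun a => a.elim0⟩
  have : NeZero K := ⟨hK.ne'⟩
  obtain ⟨R, hR, hRU, h11, h22⟩ := exists_posSemidef_dilation hU
  have hz (k : Fin 4) : star (Complex.I ^ (k : ℕ)) * Complex.I ^ (k : ℕ) = 1 := by
    rw [Complex.star_def, Complex.conj_mul']
    simp
  refine ⟨fun k a => (2 : ℂ)⁻¹ • ((phaseDiag n (Complex.I ^ (k : ℕ)))ᴴ * R a *
    phaseDiag n (Complex.I ^ (k : ℕ))), fun k a => ?_, fun k => ?_, fun a => ?_⟩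
  · exact ((hR a).conjTranspose_mul_mul_same _).smul (by positivity)
  · set z := Complex.I ^ (k : ℕ)
    rw [← Finset.smul_sum, ← Finset.sum_mul, ← Finset.mul_sum]
    have hsum : ∑ a, R a = fromBlocks 1 (∑ a, R a).toBlocks₁₂ (∑ a, R a).toBlocks₂₁ 1 := by
      conv_lhs => rw [← fromBlocks_toBlocks (∑ a, R a), h11, h22]
    -- As `∑ R` has identity diagonal blocks, its conjugates by `diag(1, z)` and `diag(1, -z)` add
    -- up to 2; hence the complement is again positive.
    have : 1 - (2 : ℂ)⁻¹ • ((phaseDiag n z)ᴴ * (∑ a, R a) * phaseDiag n z) =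
        (2 : ℂ)⁻¹ • ((phaseDiag n (-z))ᴴ * (∑ a, R a) * phaseDiag n (-z)) := by
      rw [hsum, phaseDiag_conj, phaseDiag_conj, fromBlocks_smul, fromBlocks_smul,
        ← fromBlocks_one, sub_eq_iff_eq_add, fromBlocks_add]
      have h1 : star (-z) * -z = 1 := by rw [star_neg, neg_mul_neg]; exact hz k
      rw [h1, hz k, star_neg]
      congr 1 <;> module
    rw [this]
    exact ((posSemidef_sum _ fun a _ => hR a).conjTranspose_mul_mul_same _).smul (by positivity)
  -- Over the fourth roots of unity, `∑ z̄ = ∑ z̄² = 0` removes the diagonal and the lower corner,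
  -- while `∑ z̄ z = 4` keeps the upper one.
  · obtain ⟨P, W, Q, h⟩ : ∃ P W Q, R a = fromBlocks P (U a) W Q :=
      ⟨(R a).toBlocks₁₁, (R a).toBlocks₂₁, (R a).toBlocks₂₂, by rw [← hRU, fromBlocks_toBlocks]⟩
    have hI3 : Complex.I ^ 3 = -Complex.I := by rw [pow_succ, Complex.I_sq]; ring
    simp only [h, phaseDiag_conj, Fin.sum_univ_four, fromBlocks_smul, fromBlocks_add,
      Fin.coe_ofNat_eq_mod, Nat.reduceMod, pow_zero, pow_one, Complex.I_sq, hI3,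
      Complex.star_def, map_one, map_neg, Complex.conj_I, neg_neg, smul_smul, mul_neg, neg_mul,
      mul_one, one_mul, mul_left_comm Complex.I, Complex.I_mul_I]
    congr 1 <;> module

end Dilation

/-! ### Traces against density operators -/

section Trace

variable {H : Type} [NormedAddCommGroup H] [InnerProductSpace ℂ H]

theorem hasSum_norm_inner_sq {ι : Type*} (b : HilbertBasis ι ℂ H) (x : H) :
    HasSum (fun i => ‖⟪b i, x⟫_ℂ‖ ^ 2) (‖x‖ ^ 2) := by
  have h := b.hasSum_inner_mul_inner x x
  have h2 := Complex.hasSum_re h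
  convert h2 using 1
  · funext i
    rw [← inner_conj_symm x (b i), Complex.conj_mul']
    norm_cast
  · rw [inner_self_eq_norm_sq_to_K]
    norm_cast

theorem hasTrace_comp_rankOne (T : H →L[ℂ] H) (ζ : H) :
    HasTrace (T ∘L InnerProductSpace.rankOne ℂ ζ ζ) ⟪ζ, T ζ⟫_ℂ := by
  intro ι b
  refine (b.hasSum_inner_mul_inner ζ (T ζ)).congr_fun fun i => ?_
  rw [ContinuousLinearMap.comp_apply, InnerProductSpace.rankOne_apply, map_smul, inner_smul_right]

variable [CompleteSpace H]

/-- The Hilbert–Schmidt norm of an operator and of its adjoint agree. -/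
theorem tsum_ofReal_norm_sq_adjoint {ι : Type*} (b : HilbertBasis ι ℂ H) (A : H →L[ℂ] H) :
    ∑' i, ENNReal.ofReal (‖A (b i)‖ ^ 2) =
      ∑' i, ENNReal.ofReal (‖ContinuousLinearMap.adjoint A (b i)‖ ^ 2) := by
  have key (B : H →L[ℂ] H) (i : ι) : ENNReal.ofReal (‖B (b i)‖ ^ 2) =
      ∑' j, ENNReal.ofReal (‖⟪b j, B (b i)⟫_ℂ‖ ^ 2) := by
    have h := hasSum_norm_inner_sq b (B (b i))
    rw [← h.tsum_eq, ENNReal.ofReal_tsum_of_nonneg (fun _ => by positivity) h.summable]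
  simp only [key]
  rw [ENNReal.tsum_comm]
  refine tsum_congr fun i => tsum_congr fun j => ?_
  rw [ContinuousLinearMap.adjoint_inner_right, ← inner_conj_symm, RCLike.norm_conj]

/-- With `s = √ρ`, the diagonal terms are `⟪s T* b_i, s b_i⟫`. Cauchy–Schwarz leaves two
Hilbert–Schmidt norms: `‖s‖² = tr ρ = 1` and `‖s T*‖ = ‖T s‖ ≤ ‖T‖`. A single basis is enough. -/
theorem norm_trace_comp_le {ρ T : H →L[ℂ] H} (hρ : IsDensity ρ) {t : ℂ}
    (ht : HasTrace (T ∘L ρ) t) : ‖t‖ ≤ ‖T‖ := by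
  obtain ⟨w, b, -⟩ := exists_hilbertBasis ℂ H
  obtain ⟨hpos, htr⟩ := hρ
  set s := CFC.sqrt ρ
  have hss : s ∘L s = ρ := CFC.sqrt_mul_sqrt_self ρ hpos
  have hsa : ContinuousLinearMap.adjoint s = s := (CFC.sqrt_nonneg ρ).isSelfAdjoint
  have hinner (x y : H) : ⟪x, ρ y⟫_ℂ = ⟪s x, s y⟫_ℂ := by
    rw [← hss, ContinuousLinearMap.comp_apply, ← ContinuousLinearMap.adjoint_inner_left, hsa]
  have hc : HasSum (fun i => ‖s (b i)‖ ^ 2) 1 := by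
    have h := Complex.hasSum_re (htr w b)
    rw [Complex.one_re] at h
    refine h.congr_fun fun i => ?_
    rw [hinner, inner_self_eq_norm_sq_to_K]
    norm_cast
  set d : w → ℝ := fun i => ‖s (ContinuousLinearMap.adjoint T (b i))‖ ^ 2
  have hd (F : Finset w) : ∑ i ∈ F, d i ≤ ‖T‖ ^ 2 := by
    have h1 : ∑' i, ENNReal.ofReal (d i) ≤ ENNReal.ofReal (‖T‖ ^ 2) := by
      have h2 := tsum_ofReal_norm_sq_adjoint b (s ∘L ContinuousLinearMap.adjoint T)
      rw [ContinuousLinearMap.adjoint_comp, ContinuousLinearMap.adjoint_adjoint, hsa] at h2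
      refine h2.le.trans ?_
      calc ∑' i, ENNReal.ofReal (‖(T ∘L s) (b i)‖ ^ 2)
          ≤ ∑' i, ENNReal.ofReal (‖T‖ ^ 2) * ENNReal.ofReal (‖s (b i)‖ ^ 2) := by
            refine ENNReal.tsum_le_tsum fun i => ?_
            rw [← ENNReal.ofReal_mul (by positivity), ← mul_pow]
            gcongr
            exact T.le_opNorm _
        _ = ENNReal.ofReal (‖T‖ ^ 2) := by
            rw [ENNReal.tsum_mul_left,
              ← ENNReal.ofReal_tsum_of_nonneg (fun _ => by positivity) hc.summable, hc.tsum_eq]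
            simp
    have h3 := (ENNReal.sum_le_tsum F).trans h1
    rw [← ENNReal.ofReal_sum_of_nonneg fun _ _ => by positivity] at h3
    exact (ENNReal.ofReal_le_ofReal_iff (by positivity)).1 h3
  refine le_of_tendsto (ht w b).norm (Filter.Eventually.of_forall fun F => ?_)
  calc ‖∑ i ∈ F, ⟪b i, (T ∘L ρ) (b i)⟫_ℂ‖
      ≤ ∑ i ∈ F, ‖s (ContinuousLinearMap.adjoint T (b i))‖ * ‖s (b i)‖ := by
        refine (norm_sum_le _ _).trans (Finset.sum_le_sum fun i _ => ?_)
        rw [ContinuousLinearMap.comp_apply, ← ContinuousLinearMap.adjoint_inner_left, hinner]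
        exact norm_inner_le_norm _ _
    _ ≤ √(∑ i ∈ F, d i) * √(∑ i ∈ F, ‖s (b i)‖ ^ 2) := Real.sum_mul_le_sqrt_mul_sqrt _ _ _
    _ ≤ √(‖T‖ ^ 2) * √1 := by
        gcongr
        · exact hd F
        · exact sum_le_hasSum F (fun _ _ => by positivity) hc
    _ = ‖T‖ := by simp

theorem isDensity_rankOne {ζ : H} (hζ : ‖ζ‖ = 1) : IsDensity (InnerProductSpace.rankOne ℂ ζ ζ) := by
  refine ⟨?_, ?_⟩
  · rw [ContinuousLinearMap.nonneg_iff_isPositive]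
    exact InnerProductSpace.isPositive_rankOne_self ζ
  · have h := hasTrace_comp_rankOne (1 : H →L[ℂ] H) ζ
    have h1 : (1 : H →L[ℂ] H) ∘L InnerProductSpace.rankOne ℂ ζ ζ =
        InnerProductSpace.rankOne ℂ ζ ζ := ContinuousLinearMap.id_comp _
    simpa [h1, inner_self_eq_norm_sq_to_K, hζ] using h

end Trace

/-! ### Operators on the Hilbert space tensor product -/

section TensorOp

variable {H₁ H₂ : Type*} [NormedAddCommGroup H₁] [InnerProductSpace ℂ H₁]
  [NormedAddCommGroup H₂] [InnerProductSpace ℂ H₂]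

theorem norm_completion_le {E : Type*} [NormedAddCommGroup E] [NormedSpace ℂ E] (f : E →L[ℂ] E) :
    ‖f.completion‖ ≤ ‖f‖ := by
  refine ContinuousLinearMap.opNorm_le_bound _ (norm_nonneg _) fun x => ?_
  induction x using UniformSpace.Completion.induction_on with
  | hp => exact isClosed_le (by fun_prop) (by fun_prop)
  | ih a =>
    rw [ContinuousLinearMap.completion_apply_coe, UniformSpace.Completion.norm_coe,
      UniformSpace.Completion.norm_coe]
    exact f.le_opNorm a

theorem norm_tensorOp_le (S : H₁ →L[ℂ] H₁) (T : H₂ →L[ℂ] H₂) : ‖tensorOp S T‖ ≤ ‖S‖ * ‖T‖ :=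
  (norm_completion_le _).trans (TensorProduct.norm_mapL_le S T)

theorem tensorOp_coe_tmul (S : H₁ →L[ℂ] H₁) (T : H₂ →L[ℂ] H₂) (x : H₁) (y : H₂) :
    tensorOp S T ((x ⊗ₜ[ℂ] y : H₁ ⊗[ℂ] H₂) : HilbertTensor H₁ H₂) =
      ((S x ⊗ₜ[ℂ] T y : H₁ ⊗[ℂ] H₂) : HilbertTensor H₁ H₂) := by
  rw [tensorOp, ContinuousLinearMap.completion_apply_coe, TensorProduct.mapL_tmul]

theorem tensorOpLin_tmul (S : H₁ →L[ℂ] H₁) (T : H₂ →L[ℂ] H₂) :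
    tensorOpLin H₁ H₂ (S ⊗ₜ[ℂ] T) = tensorOp S T := rfl

/-- Needed so that the probabilities produced by a vector state are real. -/
theorem inner_tensorOp_of_symmetric {S : H₁ →L[ℂ] H₁} {T : H₂ →L[ℂ] H₂}
    (hS : (S : H₁ →ₗ[ℂ] H₁).IsSymmetric) (hT : (T : H₂ →ₗ[ℂ] H₂).IsSymmetric)
    (x y : HilbertTensor H₁ H₂) : ⟪tensorOp S T x, y⟫_ℂ = ⟪x, tensorOp S T y⟫_ℂ := by
  induction x, y using UniformSpace.Completion.induction_on₂ with
  | hp => exact isClosed_eq (by fun_prop) (by fun_prop)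
  | ih a b =>
    simp only [tensorOp, ContinuousLinearMap.completion_apply_coe,
      UniformSpace.Completion.inner_coe]
    induction a using TensorProduct.induction_on with
    | zero => simp
    | add a a' ha ha' => simp only [map_add, inner_add_left, ha, ha']
    | tmul u v =>
      induction b using TensorProduct.induction_on with
      | zero => simp
      | add b b' hb hb' => simp only [map_add, inner_add_right, hb, hb']
      | tmul u' v' =>
        rw [TensorProduct.mapL_tmul, TensorProduct.mapL_tmul, TensorProduct.inner_tmul,
          TensorProduct.inner_tmul]
        congr 1
        · exact hS u u'
        · exact hT v v'

end TensorOp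

/-! ### Operator matrices and scalar matrices acting on `ℓ₂ⁿ(H)` -/

section BlockOp

variable {H : Type*} [NormedAddCommGroup H] [InnerProductSpace ℂ H] {n : ℕ}

theorem blockOp_apply (T : Matrix (Fin n) (Fin n) (H →L[ℂ] H)) (v : PiLp 2 fun _ : Fin n => H)
    (i : Fin n) : blockOp T v i = ∑ j, T i j (v j) := by
  simp [blockOp]

theorem blockOp_sum {ι : Type*} (s : Finset ι)
    (T : ι → Matrix (Fin n) (Fin n) (H →L[ℂ] H)) :
    blockOp (∑ k ∈ s, T k) = ∑ k ∈ s, blockOp (T k) := by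
  ext v i
  simp only [blockOp_apply, Matrix.sum_apply, sum_apply, WithLp.ofLp_sum, Finset.sum_apply]
  rw [Finset.sum_comm]

theorem inner_blockOp (T : Matrix (Fin n) (Fin n) (H →L[ℂ] H))
    (s t : PiLp 2 fun _ : Fin n => H) :
    ⟪s, blockOp T t⟫_ℂ = ∑ l, ∑ k, ⟪s l, T l k (t k)⟫_ℂ := by
  simp only [PiLp.inner_apply, blockOp_apply, inner_sum]

theorem opNorm_le_of_norm_inner_le {E : Type*} [NormedAddCommGroup E] [InnerProductSpace ℂ E]
    {T : E →L[ℂ] E} {C : ℝ} (hC : 0 ≤ C) (h : ∀ x y, ‖⟪x, T y⟫_ℂ‖ ≤ C * ‖x‖ * ‖y‖) :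
    ‖T‖ ≤ C := by
  refine T.opNorm_le_bound hC fun y => ?_
  have h1 := h (T y) y
  rw [inner_self_eq_norm_sq_to_K] at h1
  simp only [Complex.coe_algebraMap, norm_pow, Complex.norm_real, norm_norm] at h1
  rcases (norm_nonneg (T y)).eq_or_lt with h0 | h0
  · rw [← h0]; positivity
  · refine le_of_mul_le_mul_left ?_ h0
    linarith

-- `A` is completed to a column `(A, C)` that is `c` times an isometry. The identity survives
-- amplification to `ℓ₂ⁿ(H)`, which bounds `A ⊗ 1` there.
open Matrix in
open scoped ComplexOrder MatrixOrder in
theorem exists_conjTranspose_mul_self_add (A : Matrix (Fin n) (Fin n) ℂ) {c : ℝ}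
    (hA : ‖toEuclideanCLM (n := Fin n) (𝕜 := ℂ) A‖ ≤ c) :
    ∃ C : Matrix (Fin n) (Fin n) ℂ, Aᴴ * A + Cᴴ * C = ((c ^ 2 : ℝ) : ℂ) • 1 := by
  have hpsd : (((c ^ 2 : ℝ) : ℂ) • (1 : Matrix (Fin n) (Fin n) ℂ) - Aᴴ * A).PosSemidef := by
    refine .of_dotProduct_mulVec_nonneg ?_ fun v => ?_
    · refine IsHermitian.sub ?_ (isHermitian_conjTranspose_mul_self A)
      rw [IsHermitian, conjTranspose_smul, conjTranspose_one, Complex.star_def, Complex.conj_ofReal]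
    · have hs (w : Fin n → ℂ) : star w ⬝ᵥ w = ((‖WithLp.toLp 2 w‖ ^ 2 : ℝ) : ℂ) := by
        rw [star_dotProduct_self, EuclideanSpace.norm_sq_eq]
      rw [sub_mulVec, dotProduct_sub, smul_mulVec, one_mulVec, dotProduct_smul,
        ← mulVec_mulVec, dotProduct_mulVec _ Aᴴ, vecMul_conjTranspose, star_star, hs, hs,
        smul_eq_mul, ← Complex.ofReal_mul, ← Complex.ofReal_sub, Complex.zero_le_real,
        sub_nonneg, ← mul_pow]
      have h := (toEuclideanCLM (n := Fin n) (𝕜 := ℂ) A).le_of_opNorm_le hA (WithLp.toLp 2 v)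
      rw [toEuclideanCLM_toLp] at h
      gcongr
  obtain ⟨C, hC⟩ := CStarAlgebra.nonneg_iff_eq_star_mul_self.mp hpsd.nonneg
  refine ⟨C, ?_⟩
  rw [← star_eq_conjTranspose C, ← hC]
  abel

open Matrix in
theorem sum_norm_sq_sum_smul (A : Matrix (Fin n) (Fin n) ℂ) (y : Fin n → H) :
    ((∑ l, ‖∑ k, A l k • y k‖ ^ 2 : ℝ) : ℂ) = ∑ k, ∑ k', (Aᴴ * A) k k' * ⟪y k, y k'⟫_ℂ := by
  push_cast
  have h (x : H) : (‖x‖ : ℂ) ^ 2 = ⟪x, x⟫_ℂ := (inner_self_eq_norm_sq_to_K x).symm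
  have h' (l : Fin n) : ⟪∑ k, A l k • y k, ∑ k, A l k • y k⟫_ℂ =
      ∑ k, ∑ k', star (A l k) * A l k' * ⟪y k, y k'⟫_ℂ := by
    rw [sum_inner]
    refine Finset.sum_congr rfl fun k _ => ?_
    rw [inner_sum]
    refine Finset.sum_congr rfl fun k' _ => ?_
    rw [inner_smul_left, inner_smul_right, Complex.star_def, mul_assoc]
  simp only [h, h', Matrix.mul_apply, conjTranspose_apply, Finset.sum_mul]
  rw [Finset.sum_comm]
  exact Finset.sum_congr rfl fun k _ => Finset.sum_comm

/-- A scalar matrix acts on `ℓ₂ⁿ(H)` with its operator norm. -/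
theorem sum_norm_sq_sum_smul_le (A : Matrix (Fin n) (Fin n) ℂ) {c : ℝ}
    (hA : ‖Matrix.toEuclideanCLM (n := Fin n) (𝕜 := ℂ) A‖ ≤ c) (y : Fin n → H) :
    ∑ l, ‖∑ k, A l k • y k‖ ^ 2 ≤ c ^ 2 * ∑ k, ‖y k‖ ^ 2 := by
  obtain ⟨C, hC⟩ := exists_conjTranspose_mul_self_add A hA
  have h : ((∑ l, ‖∑ k, A l k • y k‖ ^ 2 + ∑ l, ‖∑ k, C l k • y k‖ ^ 2 : ℝ) : ℂ) =
      ((c ^ 2 * ∑ k, ‖y k‖ ^ 2 : ℝ) : ℂ) := by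
    rw [Complex.ofReal_add, sum_norm_sq_sum_smul, sum_norm_sq_sum_smul]
    simp only [← Finset.sum_add_distrib, ← add_mul, ← Matrix.add_apply, hC]
    simp [Matrix.one_apply, Finset.mul_sum, inner_self_eq_norm_sq_to_K]
  have h' := Complex.ofReal_injective h
  have : 0 ≤ ∑ l, ‖∑ k, C l k • y k‖ ^ 2 := by positivity
  linarith

theorem norm_sum_mul_inner_le (A : Matrix (Fin n) (Fin n) ℂ) {c : ℝ}
    (hA : ‖Matrix.toEuclideanCLM (n := Fin n) (𝕜 := ℂ) A‖ ≤ c) (x y : Fin n → H) :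
    ‖∑ l, ∑ k, A l k * ⟪x l, y k⟫_ℂ‖ ≤ c * (√(∑ l, ‖x l‖ ^ 2) * √(∑ k, ‖y k‖ ^ 2)) := by
  have hc : 0 ≤ c := (norm_nonneg _).trans hA
  calc ‖∑ l, ∑ k, A l k * ⟪x l, y k⟫_ℂ‖ = ‖∑ l, ⟪x l, ∑ k, A l k • y k⟫_ℂ‖ := by
        simp only [inner_sum, inner_smul_right]
    _ ≤ ∑ l, ‖x l‖ * ‖∑ k, A l k • y k‖ :=
        (norm_sum_le _ _).trans (Finset.sum_le_sum fun l _ => norm_inner_le_norm _ _)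
    _ ≤ √(∑ l, ‖x l‖ ^ 2) * √(∑ l, ‖∑ k, A l k • y k‖ ^ 2) :=
        Real.sum_mul_le_sqrt_mul_sqrt _ _ _
    _ ≤ √(∑ l, ‖x l‖ ^ 2) * √(c ^ 2 * ∑ k, ‖y k‖ ^ 2) := by
        gcongr
        exact sum_norm_sq_sum_smul_le A hA y
    _ = _ := by
        rw [Real.sqrt_mul (sq_nonneg c), Real.sqrt_sq hc]
        ring

end BlockOp

/-! ### Incomplete POVMs as complete contractions -/

section CompleteContraction

variable {H : Type*} [NormedAddCommGroup H] [InnerProductSpace ℂ H] {N K : ℕ}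

/-- The linear map `ℓ_∞^K → B(H)` sending `e_a` to `E a`. -/
def coeffMap (E : Fin K → (H →L[ℂ] H)) : (Fin K → ℂ) →ₗ[ℂ] (H →L[ℂ] H) where
  toFun f := ∑ a, f a • E a
  map_add' f g := by simp only [Pi.add_apply, add_smul, Finset.sum_add_distrib]
  map_smul' c f := by simp only [Pi.smul_apply, smul_assoc, Finset.smul_sum, RingHom.id_apply]

theorem coeffMap_apply (E : Fin K → (H →L[ℂ] H)) (f : Fin K → ℂ) :
    coeffMap E f = ∑ a, f a • E a := rfl

theorem norm_le_supNorms {n : ℕ} (A : Matrix (Fin n) (Fin n) (Fin K → ℂ)) (a : Fin K) :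
    ‖Matrix.toEuclideanCLM (n := Fin n) (𝕜 := ℂ) (A.map fun f => f a)‖ ≤ supNorms K n A :=
  le_ciSup (f := fun k : Fin K =>
    ‖Matrix.toEuclideanCLM (n := Fin n) (𝕜 := ℂ) (A.map fun f => f k)‖)
    (Set.finite_range _).bddAbove a

theorem supNorms_nonneg {n : ℕ} (A : Matrix (Fin n) (Fin n) (Fin K → ℂ)) : 0 ≤ supNorms K n A :=
  Real.iSup_nonneg fun _ => norm_nonneg _

/-- With `r a = √(E a)`, the map `V x = (r a x)_a` is a contraction because `∑ E a ≤ 1`, and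
`coeffMap E f = V* diag(f) V`. The matrix estimate is Cauchy–Schwarz in this factorisation. -/
theorem isCompleteContraction_coeffMap [CompleteSpace H] {E : Fin K → (H →L[ℂ] H)}
    (hE : ∀ a, 0 ≤ E a) (hsum : ∑ a, E a ≤ 1) :
    IsCompleteContraction (supNorms K) (opNorms H) (coeffMap E) := by
  intro n A
  set c := supNorms K n A
  have hc : 0 ≤ c := supNorms_nonneg A
  set r : Fin K → (H →L[ℂ] H) := fun a => CFC.sqrt (E a)
  have hr (a) (x y : H) : ⟪x, E a y⟫_ℂ = ⟪r a x, r a y⟫_ℂ := by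
    have hss : r a ∘L r a = E a := CFC.sqrt_mul_sqrt_self (E a) (hE a)
    have hsa : ContinuousLinearMap.adjoint (r a) = r a := (CFC.sqrt_nonneg (E a)).isSelfAdjoint
    rw [← hss, ContinuousLinearMap.comp_apply, ← ContinuousLinearMap.adjoint_inner_left, hsa]
  have hrs (x : H) : ∑ a, ‖r a x‖ ^ 2 ≤ ‖x‖ ^ 2 := by
    have h := (ContinuousLinearMap.le_def _ _).1 hsum
    have h' := h.re_inner_nonneg_right x
    have e : ∑ a, ‖r a x‖ ^ 2 = RCLike.re ⟪x, (∑ a, E a) x⟫_ℂ := by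
      rw [sum_apply, inner_sum, map_sum]
      refine Finset.sum_congr rfl fun a _ => ?_
      rw [hr, inner_self_eq_norm_sq]
    rw [sub_apply, inner_sub_right, map_sub, ← e, one_apply_eq_self, inner_self_eq_norm_sq] at h'
    linarith
  refine opNorm_le_of_norm_inner_le hc fun s t => ?_
  have hsq (s : PiLp 2 fun _ : Fin n => H) : ∑ a, ∑ l, ‖r a (s l)‖ ^ 2 ≤ ‖s‖ ^ 2 := by
    rw [Finset.sum_comm, PiLp.norm_sq_eq_of_L2]
    exact Finset.sum_le_sum fun l _ => hrs (s l)
  have hexp : ⟪s, blockOp (A.map (coeffMap E)) t⟫_ℂ =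
      ∑ a, ∑ l, ∑ k, (A.map fun f => f a) l k * ⟪r a (s l), r a (t k)⟫_ℂ := by
    simp only [inner_blockOp, Matrix.map_apply, coeffMap_apply, sum_apply, smul_apply, inner_sum,
      inner_smul_right, hr]
    rw [Finset.sum_comm]
    rw [Finset.sum_comm (s := (Finset.univ : Finset (Fin K)))]
    rw [Finset.sum_comm]
    exact Finset.sum_congr rfl fun l _ => Finset.sum_comm
  rw [hexp]
  calc _ ≤ ∑ a, c * (√(∑ l, ‖r a (s l)‖ ^ 2) * √(∑ k, ‖r a (t k)‖ ^ 2)) :=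
        (norm_sum_le _ _).trans (Finset.sum_le_sum fun a _ =>
          norm_sum_mul_inner_le _ (norm_le_supNorms A a) _ _)
    _ = c * ∑ a, √(∑ l, ‖r a (s l)‖ ^ 2) * √(∑ k, ‖r a (t k)‖ ^ 2) := by rw [Finset.mul_sum]
    _ ≤ c * (√(∑ a, √(∑ l, ‖r a (s l)‖ ^ 2) ^ 2) * √(∑ a, √(∑ k, ‖r a (t k)‖ ^ 2) ^ 2)) := by
        gcongr
        exact Real.sum_mul_le_sqrt_mul_sqrt _ _ _
    _ ≤ c * (√(‖s‖ ^ 2) * √(‖t‖ ^ 2)) := by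
        have hq (s : PiLp 2 fun _ : Fin n => H) : ∑ a, √(∑ l, ‖r a (s l)‖ ^ 2) ^ 2 ≤ ‖s‖ ^ 2 := by
          refine (Finset.sum_le_sum fun a _ => ?_).trans (hsq s)
          rw [Real.sq_sqrt (by positivity)]
        gcongr
        · exact hq s
        · exact hq t
    _ = c * ‖s‖ * ‖t‖ := by
        rw [Real.sqrt_sq (norm_nonneg _), Real.sqrt_sq (norm_nonneg _), mul_assoc]

/-- The map `(e_i)_i ↦ ∑ u_i (e_i)` on an `ℓ₁`-sum. -/
def oneSumMap {E : Type*} [AddCommGroup E] [Module ℂ E] (u : Fin N → (E →ₗ[ℂ] (H →L[ℂ] H))) :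
    PiLp 1 (fun _ : Fin N => E) →ₗ[ℂ] (H →L[ℂ] H) where
  toFun e := ∑ i, u i (e i)
  map_add' e f := by
    simp only [WithLp.ofLp_add, Pi.add_apply, map_add, Finset.sum_add_distrib]
  map_smul' c e := by
    simp only [WithLp.ofLp_smul, Pi.smul_apply, map_smul, Finset.smul_sum, RingHom.id_apply]

theorem oneSumMap_apply {E : Type*} [AddCommGroup E] [Module ℂ E]
    (u : Fin N → (E →ₗ[ℂ] (H →L[ℂ] H))) (e : PiLp 1 (fun _ : Fin N => E)) :
    oneSumMap u e = ∑ i, u i (e i) := rfl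

end CompleteContraction

/-! ### Complete contractions on `ℓ₁`-sums -/

section OneSum

variable {N K : ℕ} {E : Type*} [AddCommGroup E] [Module ℂ E] {ν : MatrixNorms E}

/-- This triangle inequality does not involve `H` or `u` on the right, so the supremum defining
`oneSumNorms` is bounded. -/
theorem opNorms_map_oneSum_le {H : Type} [NormedAddCommGroup H] [InnerProductSpace ℂ H]
    {u : Fin N → (E →ₗ[ℂ] (H →L[ℂ] H))}
    (hu : ∀ i, IsCompleteContraction ν (opNorms H) (u i)) (n : ℕ)
    (A : Matrix (Fin n) (Fin n) (PiLp 1 fun _ : Fin N => E)) :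
    opNorms H n (A.map fun e => ∑ i, u i (e i)) ≤ ∑ i, ν n (A.map fun e => e i) := by
  have h : (A.map fun e => ∑ i, u i (e i)) = ∑ i, (A.map fun e => e i).map (u i) := by
    ext1 l k
    simp [Matrix.sum_apply]
  rw [h]
  change ‖blockOp (∑ i, (A.map fun e => e i).map (u i))‖ ≤ _
  rw [blockOp_sum]
  refine (norm_sum_le Finset.univ fun i => blockOp ((A.map fun e => e i).map (u i))).trans
    (Finset.sum_le_sum fun i _ => ?_)
  exact hu i n (A.map fun e => e i)

theorem isCompleteContraction_oneSumMap {H : Type} [NormedAddCommGroup H]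
    [InnerProductSpace ℂ H] [CompleteSpace H] {u : Fin N → (E →ₗ[ℂ] (H →L[ℂ] H))}
    (hu : ∀ i, IsCompleteContraction ν (opNorms H) (u i)) :
    IsCompleteContraction (oneSumNorms N ν) (opNorms H) (oneSumMap u) := by
  intro n A
  refine le_csSup ⟨∑ i, ν n (A.map fun e => e i), ?_⟩ ⟨H, _, _, inferInstance, u, hu, rfl⟩
  rintro r ⟨H', _, _, _, u', hu', rfl⟩
  exact opNorms_map_oneSum_le hu' n A

/-- The inclusion of the `x`-th summand. -/
def oneSumIncl (x : Fin N) : E →ₗ[ℂ] PiLp 1 (fun _ : Fin N => E) where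
  toFun e := WithLp.toLp 1 (Pi.single x e)
  map_add' e f := by rw [Pi.single_add, WithLp.toLp_add]
  map_smul' c e := by rw [Pi.single_smul, WithLp.toLp_smul, RingHom.id_apply]

/-- On the image of one summand only the `x`-th competing map `v x` acts, so the inclusion is itself
contractive at every matrix level. -/
theorem isCompleteContraction_comp_oneSumIncl {H : Type} [NormedAddCommGroup H]
    [InnerProductSpace ℂ H] (hν : ∀ n A, 0 ≤ ν n A)
    {u : PiLp 1 (fun _ : Fin N => E) →ₗ[ℂ] (H →L[ℂ] H)}
    (hu : IsCompleteContraction (oneSumNorms N ν) (opNorms H) u) (x : Fin N) :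
    IsCompleteContraction ν (opNorms H) (u ∘ₗ oneSumIncl x) := by
  intro n A
  refine (hu n (A.map (oneSumIncl x))).trans (Real.sSup_le ?_ (hν n A))
  rintro r ⟨H', _, _, _, v, hv, rfl⟩
  refine le_of_eq_of_le ?_ (hv x n A)
  congr 1
  ext1 l k
  simp only [Matrix.map_apply]
  rw [Finset.sum_eq_single x]
  · simp [oneSumIncl]
  · intro i _ hi
    simp [oneSumIncl, hi]
  · simp

end OneSum

/-! ### Bell operators and their linearity in each party -/

theorem sum_smul_sum_smul_comm {N K : ℕ} {V κ : Type*} [AddCommMonoid V] [Module ℂ V]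
    [Fintype κ] (M : BellFunctional N K) (c : κ → ℂ)
    (t : κ → Fin N → Fin N → Fin K → Fin K → V) :
    ∑ x, ∑ y, ∑ a, ∑ b, M x y a b • ∑ k, c k • t k x y a b =
      ∑ k, c k • ∑ x, ∑ y, ∑ a, ∑ b, M x y a b • t k x y a b := by
  simp only [Finset.smul_sum]
  symm
  rw [Finset.sum_comm]
  refine Finset.sum_congr rfl fun x _ => ?_
  rw [Finset.sum_comm]
  refine Finset.sum_congr rfl fun y _ => ?_
  rw [Finset.sum_comm]
  refine Finset.sum_congr rfl fun a _ => ?_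
  rw [Finset.sum_comm]
  refine Finset.sum_congr rfl fun b _ => Finset.sum_congr rfl fun k _ => smul_comm _ _ _

theorem norm_sum_smul_le {N K : ℕ} {V : Type*} [SeminormedAddCommGroup V] [NormedSpace ℂ V]
    (M : BellFunctional N K) {t : Fin N → Fin N → Fin K → Fin K → V} {c : Fin K → Fin K → ℝ}
    (ht : ∀ x y a b, ‖t x y a b‖ ≤ c a b) :
    ‖∑ x, ∑ y, ∑ a, ∑ b, M x y a b • t x y a b‖ ≤
      ∑ x, ∑ y, ∑ a, ∑ b, ‖M x y a b‖ * c a b := by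
  refine (norm_sum_le _ _).trans (Finset.sum_le_sum fun x _ => ?_)
  refine (norm_sum_le _ _).trans (Finset.sum_le_sum fun y _ => ?_)
  refine (norm_sum_le _ _).trans (Finset.sum_le_sum fun a _ => ?_)
  refine (norm_sum_le _ _).trans (Finset.sum_le_sum fun b _ => ?_)
  rw [norm_smul]
  exact mul_le_mul_of_nonneg_left (ht x y a b) (norm_nonneg _)

section BellOp

variable {H₁ H₂ : Type*} [NormedAddCommGroup H₁] [InnerProductSpace ℂ H₁]
  [NormedAddCommGroup H₂] [InnerProductSpace ℂ H₂] {N K : ℕ}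

/-- The Bell operator `∑ M_{x,y}^{a,b} S_x^a ⊗ T_y^b`. -/
def bellOp (M : BellFunctional N K) (S : Fin N → Fin K → (H₁ →L[ℂ] H₁))
    (T : Fin N → Fin K → (H₂ →L[ℂ] H₂)) : HilbertTensor H₁ H₂ →L[ℂ] HilbertTensor H₁ H₂ :=
  ∑ x, ∑ y, ∑ a, ∑ b, M x y a b • tensorOp (S x a) (T y b)

theorem tensorOpLin_map_bellTensor (M : BellFunctional N K)
    (u : L1Linf N K →ₗ[ℂ] (H₁ →L[ℂ] H₁)) (v : L1Linf N K →ₗ[ℂ] (H₂ →L[ℂ] H₂)) :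
    tensorOpLin H₁ H₂ (TensorProduct.map u v (bellTensor M)) =
      bellOp M (fun x a => u (basisVec x a)) (fun y b => v (basisVec y b)) := by
  simp only [bellTensor, map_sum, map_smul, TensorProduct.map_tmul, tensorOpLin_tmul, bellOp]

theorem tensorOp_sum_smul_left {κ : Type*} [Fintype κ] (c : κ → ℂ) (S : κ → (H₁ →L[ℂ] H₁))
    (T : H₂ →L[ℂ] H₂) : tensorOp (∑ k, c k • S k) T = ∑ k, c k • tensorOp (S k) T := by
  simp only [← tensorOpLin_tmul, TensorProduct.sum_tmul, map_sum, map_smul,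
    ← TensorProduct.smul_tmul']

theorem tensorOp_sum_smul_right {κ : Type*} [Fintype κ] (c : κ → ℂ) (S : H₁ →L[ℂ] H₁)
    (T : κ → (H₂ →L[ℂ] H₂)) : tensorOp S (∑ k, c k • T k) = ∑ k, c k • tensorOp S (T k) := by
  simp only [← tensorOpLin_tmul, TensorProduct.tmul_sum, map_sum, TensorProduct.tmul_smul,
    map_smul]

theorem bellOp_sum_smul_left {κ : Type*} [Fintype κ] (M : BellFunctional N K) (c : κ → ℂ)
    (S : κ → Fin N → Fin K → (H₁ →L[ℂ] H₁)) (T : Fin N → Fin K → (H₂ →L[ℂ] H₂)) :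
    bellOp M (fun x a => ∑ k, c k • S k x a) T = ∑ k, c k • bellOp M (S k) T := by
  simp only [bellOp, tensorOp_sum_smul_left]
  exact sum_smul_sum_smul_comm M c fun k x y a b => tensorOp (S k x a) (T y b)

theorem bellOp_sum_smul_right {κ : Type*} [Fintype κ] (M : BellFunctional N K) (c : κ → ℂ)
    (S : Fin N → Fin K → (H₁ →L[ℂ] H₁)) (T : κ → Fin N → Fin K → (H₂ →L[ℂ] H₂)) :
    bellOp M S (fun y b => ∑ k, c k • T k y b) = ∑ k, c k • bellOp M S (T k) := by
  simp only [bellOp, tensorOp_sum_smul_right]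
  exact sum_smul_sum_smul_comm M c fun k x y a b => tensorOp (S x a) (T k y b)

theorem inner_bellOp (M : BellFunctional N K) (S : Fin N → Fin K → (H₁ →L[ℂ] H₁))
    (T : Fin N → Fin K → (H₂ →L[ℂ] H₂)) (ξ η : HilbertTensor H₁ H₂) :
    ⟪ξ, bellOp M S T η⟫_ℂ =
      ∑ x, ∑ y, ∑ a, ∑ b, M x y a b * ⟪ξ, tensorOp (S x a) (T y b) η⟫_ℂ := by
  simp only [bellOp, sum_apply, smul_apply, inner_sum, inner_smul_right]

theorem norm_bellOp_le (M : BellFunctional N K) {S : Fin N → Fin K → (H₁ →L[ℂ] H₁)}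
    {T : Fin N → Fin K → (H₂ →L[ℂ] H₂)} {c : Fin K → ℝ} (hS : ∀ x a, ‖S x a‖ ≤ c a)
    (hT : ∀ y b, ‖T y b‖ ≤ c b) :
    ‖bellOp M S T‖ ≤ ∑ x, ∑ y, ∑ a, ∑ b, ‖M x y a b‖ * (c a * c b) := by
  have h (x y a b) : ‖tensorOp (S x a) (T y b)‖ ≤ c a * c b :=
    (norm_tensorOp_le (S x a) (T y b)).trans
      (mul_le_mul (hS x a) (hT y b) (T y b).opNorm_nonneg ((S x a).opNorm_nonneg.trans (hS x a)))
  exact norm_sum_smul_le (V := HilbertTensor H₁ H₂ →L[ℂ] HilbertTensor H₁ H₂) M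
    (t := fun x y a b => tensorOp (S x a) (T y b)) (c := fun a b => c a * c b) h

end BellOp

/-! ### The bound of `quantumBound` by `bellMinNorm`, and vector states -/

section MinNorm

variable {N K : ℕ}

theorem norm_le_norm_blockOp_one {H : Type*} [NormedAddCommGroup H] [InnerProductSpace ℂ H]
    (T : H →L[ℂ] H) : ‖T‖ ≤ ‖blockOp (n := 1) (fun _ _ => T)‖ := by
  refine T.opNorm_le_bound (ContinuousLinearMap.opNorm_nonneg _) fun v => ?_
  have h := (blockOp (n := 1) (fun _ _ => T)).le_opNorm (WithLp.toLp 2 fun _ => v)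
  have e := blockOp_apply (n := 1) (fun _ _ => T) (WithLp.toLp 2 fun _ => v) 0
  simp only [Fin.sum_univ_one] at e
  simpa [PiLp.norm_eq_of_L2, e] using h

/-- A bound uniform in `H` and `u`; it makes the supremum in `bellMinNorm` finite. -/
theorem norm_apply_basisVec_le {H : Type} [NormedAddCommGroup H] [InnerProductSpace ℂ H]
    {u : L1Linf N K →ₗ[ℂ] (H →L[ℂ] H)}
    (hu : IsCompleteContraction (l1LinfNorms N K) (opNorms H) u) (x : Fin N) (a : Fin K) :
    ‖u (basisVec x a)‖ ≤ supNorms K 1 (fun _ _ => Pi.single a 1) :=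
  (norm_le_norm_blockOp_one _).trans
    (isCompleteContraction_comp_oneSumIncl (fun _ A => supNorms_nonneg A) hu x 1
      (fun _ _ => Pi.single a 1))

theorem norm_bellOp_le_bellMinNorm (M : BellFunctional N K) {H₁ H₂ : Type}
    [NormedAddCommGroup H₁] [InnerProductSpace ℂ H₁] [CompleteSpace H₁]
    [NormedAddCommGroup H₂] [InnerProductSpace ℂ H₂] [CompleteSpace H₂]
    {u : L1Linf N K →ₗ[ℂ] (H₁ →L[ℂ] H₁)} {v : L1Linf N K →ₗ[ℂ] (H₂ →L[ℂ] H₂)}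
    (hu : IsCompleteContraction (l1LinfNorms N K) (opNorms H₁) u)
    (hv : IsCompleteContraction (l1LinfNorms N K) (opNorms H₂) v) :
    ‖bellOp M (fun x a => u (basisVec x a)) (fun y b => v (basisVec y b))‖ ≤ bellMinNorm M := by
  refine le_csSup ⟨∑ x : Fin N, ∑ y : Fin N, ∑ a, ∑ b, ‖M x y a b‖ *
      (supNorms K 1 (fun _ _ => Pi.single a 1) * supNorms K 1 (fun _ _ => Pi.single b 1)), ?_⟩
    ⟨H₁, _, _, inferInstance, H₂, _, _, inferInstance, u, v, hu, hv, ?_⟩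
  · rintro r ⟨H₁', _, _, _, H₂', _, _, _, u', v', hu', hv', rfl⟩
    rw [tensorOpLin_map_bellTensor]
    exact norm_bellOp_le M (c := fun a => supNorms K 1 (fun _ _ => Pi.single a 1))
      (norm_apply_basisVec_le hu') (norm_apply_basisVec_le hv')
  · rw [tensorOpLin_map_bellTensor]

theorem bellMinNorm_nonneg (M : BellFunctional N K) : 0 ≤ bellMinNorm M := by
  refine Real.sSup_nonneg ?_
  rintro r ⟨H₁', _, _, _, H₂', _, _, _, u', v', hu', hv', rfl⟩
  exact ContinuousLinearMap.opNorm_nonneg _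

theorem exists_completeContraction_of_povm {H : Type} [NormedAddCommGroup H]
    [InnerProductSpace ℂ H] [CompleteSpace H] {E : Fin N → Fin K → (H →L[ℂ] H)}
    (hE : IsIncompletePOVM E) :
    ∃ u : L1Linf N K →ₗ[ℂ] (H →L[ℂ] H),
      IsCompleteContraction (l1LinfNorms N K) (opNorms H) u ∧
      (fun x a => u (basisVec x a)) = E := by
  refine ⟨oneSumMap fun x => coeffMap (E x), isCompleteContraction_oneSumMap fun x =>
    isCompleteContraction_coeffMap (hE.1 x) (hE.2 x), ?_⟩
  funext x a
  rw [oneSumMap_apply, Finset.sum_eq_single x]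
  · rw [coeffMap_apply, Finset.sum_eq_single a]
    · simp [basisVec]
    · intro a' _ ha
      simp [basisVec, ha]
    · simp
  · intro x' _ hx
    simp [basisVec, hx]
  · simp

theorem norm_bellOp_povm_le (M : BellFunctional N K) {H₁ H₂ : Type}
    [NormedAddCommGroup H₁] [InnerProductSpace ℂ H₁] [CompleteSpace H₁]
    [NormedAddCommGroup H₂] [InnerProductSpace ℂ H₂] [CompleteSpace H₂]
    {E : Fin N → Fin K → (H₁ →L[ℂ] H₁)} {F : Fin N → Fin K → (H₂ →L[ℂ] H₂)}
    (hE : IsIncompletePOVM E) (hF : IsIncompletePOVM F) : ‖bellOp M E F‖ ≤ bellMinNorm M := by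
  obtain ⟨u, hu, rfl⟩ := exists_completeContraction_of_povm hE
  obtain ⟨v, hv, rfl⟩ := exists_completeContraction_of_povm hF
  exact norm_bellOp_le_bellMinNorm M hu hv

theorem norm_pairing_le_bellMinNorm (M : BellFunctional N K) {P : Behaviour N K}
    (hP : IsIncompleteQuantum P) : ‖pairing M P‖ ≤ bellMinNorm M := by
  obtain ⟨H₁, _, _, _, H₂, _, _, _, E, F, ρ, hE, hF, hρ, hP⟩ := hP
  refine (norm_trace_comp_le (T := bellOp M E F) hρ fun ι b => ?_).trans
    (norm_bellOp_povm_le M hE hF)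
  have h := hasSum_sum fun x (_ : x ∈ Finset.univ) => hasSum_sum fun y (_ : y ∈ Finset.univ) =>
    hasSum_sum fun a (_ : a ∈ Finset.univ) => hasSum_sum fun b' (_ : b' ∈ Finset.univ) =>
      (hP x y a b' ι b).mul_left (M x y a b')
  refine h.congr_fun fun i => ?_
  rw [ContinuousLinearMap.comp_apply, inner_bellOp]
  rfl

theorem quantumBound_le_bellMinNorm (M : BellFunctional N K) :
    quantumBound M ≤ bellMinNorm M := by
  refine Real.sSup_le ?_ (bellMinNorm_nonneg M)
  rintro r ⟨P, hP, rfl⟩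
  exact norm_pairing_le_bellMinNorm M hP

theorem norm_pairing_le_quantumBound (M : BellFunctional N K) {P : Behaviour N K}
    (hP : IsIncompleteQuantum P) : ‖pairing M P‖ ≤ quantumBound M := by
  refine le_csSup ⟨bellMinNorm M, ?_⟩ ⟨P, hP, rfl⟩
  rintro r ⟨P, hP, rfl⟩
  exact norm_pairing_le_bellMinNorm M hP

theorem quantumBound_nonneg (M : BellFunctional N K) : 0 ≤ quantumBound M := by
  refine Real.sSup_nonneg ?_
  rintro r ⟨P, hP, rfl⟩
  exact norm_nonneg _

/-- The pure state at `ζ` turns the diagonal form of the Bell operator into the pairing with an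
incomplete quantum behaviour. -/
theorem norm_inner_bellOp_le_of_norm_eq_one (M : BellFunctional N K) {H₁ H₂ : Type}
    [NormedAddCommGroup H₁] [InnerProductSpace ℂ H₁] [CompleteSpace H₁]
    [NormedAddCommGroup H₂] [InnerProductSpace ℂ H₂] [CompleteSpace H₂]
    {E : Fin N → Fin K → (H₁ →L[ℂ] H₁)} {F : Fin N → Fin K → (H₂ →L[ℂ] H₂)}
    (hE : IsIncompletePOVM E) (hF : IsIncompletePOVM F) {ζ : HilbertTensor H₁ H₂}
    (hζ : ‖ζ‖ = 1) : ‖⟪ζ, bellOp M E F ζ⟫_ℂ‖ ≤ quantumBound M := by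
  have hreal (x y a b) : ((⟪ζ, tensorOp (E x a) (F y b) ζ⟫_ℂ).re : ℂ) =
      ⟪ζ, tensorOp (E x a) (F y b) ζ⟫_ℂ := by
    rw [← Complex.conj_eq_iff_re, inner_conj_symm]
    exact inner_tensorOp_of_symmetric
      ((ContinuousLinearMap.nonneg_iff_isPositive _).1 (hE.1 x a)).isSymmetric
      ((ContinuousLinearMap.nonneg_iff_isPositive _).1 (hF.1 y b)).isSymmetric ζ ζ
  have h := norm_pairing_le_quantumBound M
    (P := fun x y a b => (⟪ζ, tensorOp (E x a) (F y b) ζ⟫_ℂ).re)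
    ⟨H₁, _, _, inferInstance, H₂, _, _, inferInstance, E, F, InnerProductSpace.rankOne ℂ ζ ζ,
      hE, hF, isDensity_rankOne hζ, fun x y a b => by
        rw [hreal]
        exact hasTrace_comp_rankOne _ ζ⟩
  rw [inner_bellOp]
  simpa only [pairing, hreal] using h

theorem norm_inner_bellOp_le (M : BellFunctional N K) {H₁ H₂ : Type}
    [NormedAddCommGroup H₁] [InnerProductSpace ℂ H₁] [CompleteSpace H₁]
    [NormedAddCommGroup H₂] [InnerProductSpace ℂ H₂] [CompleteSpace H₂]
    {E : Fin N → Fin K → (H₁ →L[ℂ] H₁)} {F : Fin N → Fin K → (H₂ →L[ℂ] H₂)}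
    (hE : IsIncompletePOVM E) (hF : IsIncompletePOVM F) (ζ : HilbertTensor H₁ H₂) :
    ‖⟪ζ, bellOp M E F ζ⟫_ℂ‖ ≤ quantumBound M * ‖ζ‖ ^ 2 := by
  rcases eq_or_ne ζ 0 with rfl | h0
  · simp
  have h := norm_inner_bellOp_le_of_norm_eq_one M hE hF
    (ζ := ((‖ζ‖ : ℂ)⁻¹) • ζ) (norm_smul_inv_norm h0)
  have hn : 0 < ‖ζ‖ := norm_pos_iff.2 h0
  rw [map_smul, inner_smul_left, inner_smul_right, norm_mul, norm_mul, RCLike.norm_conj,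
    norm_inv, Complex.norm_real, norm_norm] at h
  rw [← div_le_iff₀ (by positivity)]
  refine le_of_eq_of_le ?_ h
  field_simp

end MinNorm

/-! ### Finite orthonormal coordinates for tensors -/

section Coordinates

variable {H₁ H₂ : Type*} [NormedAddCommGroup H₁] [InnerProductSpace ℂ H₁]
  [NormedAddCommGroup H₂] [InnerProductSpace ℂ H₂]
  {ι κ : Type*} [Fintype ι] [Fintype κ]

/-- The vector `∑ z_{ip} f_i ⊗ g_p`. -/
def coordVec (f : ι → H₁) (g : κ → H₂) (z : ι → κ → ℂ) : HilbertTensor H₁ H₂ :=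
  ∑ i, ∑ p, z i p • ((f i ⊗ₜ[ℂ] g p : H₁ ⊗[ℂ] H₂) : HilbertTensor H₁ H₂)

theorem inner_coordVec_tensorOp (f : ι → H₁) (g : κ → H₂) (z w : ι → κ → ℂ)
    (S : H₁ →L[ℂ] H₁) (T : H₂ →L[ℂ] H₂) :
    ⟪coordVec f g z, tensorOp S T (coordVec f g w)⟫_ℂ =
      ∑ i, ∑ p, ∑ j, ∑ q,
        star (z i p) * w j q * (⟪f i, S (f j)⟫_ℂ * ⟪g p, T (g q)⟫_ℂ) := by
  simp only [coordVec, map_sum, map_smul, tensorOp_coe_tmul, sum_inner, inner_smul_left]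
  refine Finset.sum_congr rfl fun i _ => Finset.sum_congr rfl fun p _ => ?_
  simp only [inner_sum, inner_smul_right, Finset.mul_sum]
  refine Finset.sum_congr rfl fun j _ => Finset.sum_congr rfl fun q _ => ?_
  rw [UniformSpace.Completion.inner_coe, TensorProduct.inner_tmul, Complex.star_def]
  ring

theorem tensorOp_id_id : tensorOp (.id ℂ H₁) (.id ℂ H₂) = .id ℂ (HilbertTensor H₁ H₂) := by
  ext x
  induction x using UniformSpace.Completion.induction_on with
  | hp => exact isClosed_eq (by fun_prop) (by fun_prop)
  | ih a => simp [tensorOp]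

theorem norm_sq_coordVec {f : ι → H₁} {g : κ → H₂} (hf : Orthonormal ℂ f)
    (hg : Orthonormal ℂ g) (z : ι → κ → ℂ) :
    ‖coordVec f g z‖ ^ 2 = ∑ i, ∑ p, ‖z i p‖ ^ 2 := by
  classical
  have h := inner_coordVec_tensorOp f g z z (.id ℂ H₁) (.id ℂ H₂)
  rw [tensorOp_id_id, ContinuousLinearMap.id_apply, inner_self_eq_norm_sq_to_K] at h
  simp only [ContinuousLinearMap.id_apply, orthonormal_iff_ite.1 hf, orthonormal_iff_ite.1 hg,
    mul_ite, mul_one, mul_zero, Finset.sum_ite_eq, Finset.mem_univ,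
    if_true, Complex.star_def, Complex.conj_mul'] at h
  apply Complex.ofReal_injective
  push_cast
  exact h

/-- Two algebraic tensors lie in a common `E' ⊗ F'` with finite-dimensional factors, so the same
orthonormal families serve both. -/
theorem exists_coordVec_pair (ξ η : H₁ ⊗[ℂ] H₂) :
    ∃ (n m : ℕ) (f : Fin n → H₁) (g : Fin m → H₂) (z w : Fin n → Fin m → ℂ),
      Orthonormal ℂ f ∧ Orthonormal ℂ g ∧
      (ξ : HilbertTensor H₁ H₂) = coordVec f g z ∧ (η : HilbertTensor H₁ H₂) = coordVec f g w := by
  obtain ⟨E', F', hE, hF, hmem⟩ :=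
    TensorProduct.exists_finite_submodule_of_setFinite {ξ, η} (Set.toFinite _)
  obtain ⟨ξ', rfl⟩ := hmem (Set.mem_insert _ _)
  obtain ⟨η', rfl⟩ := hmem (Set.mem_insert_of_mem _ rfl)
  have := hE
  have := hF
  let e := stdOrthonormalBasis ℂ E'
  let e' := stdOrthonormalBasis ℂ F'
  have key (ζ : E' ⊗[ℂ] F') : ∃ z,
      ((TensorProduct.mapIncl E' F' ζ : H₁ ⊗[ℂ] H₂) : HilbertTensor H₁ H₂) =
      coordVec (fun i => (e i : H₁)) (fun p => (e' p : H₂)) z := by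
    refine ⟨fun i p => (e.tensorProduct e').repr ζ (i, p), ?_⟩
    conv_lhs => rw [← (e.tensorProduct e').sum_repr ζ]
    have hcoe (x : H₁ ⊗[ℂ] H₂) : (x : HilbertTensor H₁ H₂) =
      (UniformSpace.Completion.toComplL : (H₁ ⊗[ℂ] H₂) →L[ℂ] HilbertTensor H₁ H₂) x := rfl
    rw [hcoe, map_sum, map_sum, Fintype.sum_prod_type]
    simp only [map_smul, OrthonormalBasis.tensorProduct_apply, coordVec, TensorProduct.mapIncl,
      TensorProduct.map_tmul, Submodule.subtype_apply, hcoe]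
  obtain ⟨z, hz⟩ := key ξ'
  obtain ⟨w, hw⟩ := key η'
  exact ⟨_, _, _, _, z, w, e.orthonormal.comp_linearIsometry E'.subtypeₗᵢ,
    e'.orthonormal.comp_linearIsometry F'.subtypeₗᵢ, hz, hw⟩

end Coordinates

/-! ### Compressions of complete contractions -/

section Compression

variable {H : Type*} [NormedAddCommGroup H] [InnerProductSpace ℂ H] {K n : ℕ}

open Matrix

/-- The matrix of the compression of `S` to the span of `f`. -/
def compression (f : Fin n → H) (S : H →L[ℂ] H) : Matrix (Fin n) (Fin n) ℂ :=
  Matrix.of fun i j => ⟪f i, S (f j)⟫_ℂ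

theorem norm_sq_sum_smul_orthonormal {f : Fin n → H} (hf : Orthonormal ℂ f)
    (S : Matrix (Fin n) (Fin n) ℂ) :
    ‖(WithLp.toLp 2 fun l => ∑ i, S l i • f i : PiLp 2 fun _ : Fin n => H)‖ ^ 2 =
      (Sᴴ * S).trace.re := by
  rw [PiLp.norm_sq_eq_of_L2]
  have h (l) : ‖∑ i, S l i • f i‖ ^ 2 = ∑ i, ‖S l i‖ ^ 2 := by
    have h1 := hf.inner_sum (S l) (S l) Finset.univ
    rw [inner_self_eq_norm_sq_to_K] at h1
    simp only [Complex.conj_mul'] at h1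
    apply Complex.ofReal_injective
    push_cast
    exact h1
  simp only [h, Matrix.trace, Matrix.diag_apply, Matrix.mul_apply, conjTranspose_apply,
    Complex.star_def, Complex.conj_mul']
  rw [Finset.sum_comm]
  norm_cast

/-- The contractions `A_a` form one element of the unit ball of `M_n(ℓ_∞^K)`. Its image under `u`,
tested at the vectors with coordinates `S` and `T` along `f`, is the pairing in `IsTestContractive`;
the arithmetic–geometric mean inequality finishes. -/
theorem isTestContractive_compression {u : (Fin K → ℂ) →ₗ[ℂ] (H →L[ℂ] H)}
    (hu : IsCompleteContraction (supNorms K) (opNorms H) u) {f : Fin n → H}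
    (hf : Orthonormal ℂ f) :
    IsTestContractive fun a => compression f (u (Pi.single a 1)) := by
  intro A hA S T
  let A' : Matrix (Fin n) (Fin n) (Fin K → ℂ) := Matrix.of fun l k a => A a l k
  have hA' : supNorms K n A' ≤ 1 := Real.iSup_le hA zero_le_one
  have hB : ‖blockOp (A'.map u)‖ ≤ 1 := (hu n A').trans hA'
  set s : PiLp 2 fun _ : Fin n => H := WithLp.toLp 2 fun l => ∑ i, S l i • f i
  set t : PiLp 2 fun _ : Fin n => H := WithLp.toLp 2 fun l => ∑ i, T l i • f i
  have hs : ‖s‖ ^ 2 = (Sᴴ * S).trace.re := norm_sq_sum_smul_orthonormal hf S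
  have ht : ‖t‖ ^ 2 = (Tᴴ * T).trace.re := norm_sq_sum_smul_orthonormal hf T
  have hu' (l k) : A'.map u l k = ∑ a, A a l k • u (Pi.single a 1) := by
    have h1 : A' l k = ∑ a, A a l k • (Pi.single a 1 : Fin K → ℂ) := by
      ext a
      simp [A', Finset.sum_apply, Pi.single_apply]
    rw [Matrix.map_apply, h1, map_sum]
    simp only [map_smul]
  have hin : ⟪s, blockOp (A'.map u) t⟫_ℂ = ∑ a, ∑ i, ∑ j,
      compression f (u (Pi.single a 1)) i j * (Sᴴ * A a * T) i j := by
    have h1 (l k) : ⟪s l, A'.map u l k (t k)⟫_ℂ = ∑ a, ∑ i, ∑ j,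
        star (S l i) * A a l k * T k j * compression f (u (Pi.single a 1)) i j := by
      rw [hu', _root_.sum_apply, inner_sum]
      refine Finset.sum_congr rfl fun a _ => ?_
      simp only [s, t, _root_.smul_apply, map_sum, map_smul, sum_inner, inner_smul_left]
      refine Finset.sum_congr rfl fun i _ => ?_
      simp only [inner_sum, inner_smul_right, Finset.mul_sum]
      refine Finset.sum_congr rfl fun j _ => ?_
      rw [compression, Matrix.of_apply, Complex.star_def]
      ring
    have h2 (a i j) : compression f (u (Pi.single a 1)) i j * (Sᴴ * A a * T) i j =
        ∑ l, ∑ k, star (S l i) * A a l k * T k j * compression f (u (Pi.single a 1)) i j := by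
      simp only [Matrix.mul_apply, conjTranspose_apply, Finset.sum_mul, Finset.mul_sum]
      rw [Finset.sum_comm]
      refine Finset.sum_congr rfl fun l _ => Finset.sum_congr rfl fun k _ => ?_
      ring
    rw [inner_blockOp]
    simp only [h1, h2]
    calc _ = ∑ l, ∑ a, ∑ k, ∑ i, ∑ j,
          star (S l i) * A a l k * T k j * compression f (u (Pi.single a 1)) i j :=
          Finset.sum_congr rfl fun l _ => Finset.sum_comm
      _ = ∑ a, ∑ l, ∑ i, ∑ k, ∑ j,
          star (S l i) * A a l k * T k j * compression f (u (Pi.single a 1)) i j := by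
          rw [Finset.sum_comm]
          exact Finset.sum_congr rfl fun a _ => Finset.sum_congr rfl fun l _ => Finset.sum_comm
      _ = ∑ a, ∑ i, ∑ l, ∑ j, ∑ k,
          star (S l i) * A a l k * T k j * compression f (u (Pi.single a 1)) i j := by
          refine Finset.sum_congr rfl fun a _ => ?_
          rw [Finset.sum_comm]
          exact Finset.sum_congr rfl fun i _ => Finset.sum_congr rfl fun l _ => Finset.sum_comm
      _ = _ := Finset.sum_congr rfl fun a _ => Finset.sum_congr rfl fun i _ => Finset.sum_comm
  rw [← hin, ← hs, ← ht]
  have h1 : ‖⟪s, blockOp (A'.map u) t⟫_ℂ‖ ≤ ‖s‖ * ‖t‖ := by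
    refine (norm_inner_le_norm _ _).trans (mul_le_mul_of_nonneg_left ?_ (norm_nonneg _))
    simpa using (blockOp (A'.map u)).le_of_opNorm_le hB t
  nlinarith [sq_nonneg (‖s‖ - ‖t‖)]

open scoped ComplexOrder MatrixOrder in
theorem toEuclideanCLM_nonneg {ι : Type*} [Fintype ι] [DecidableEq ι] {A : Matrix ι ι ℂ}
    (hA : A.PosSemidef) : 0 ≤ toEuclideanCLM (n := ι) (𝕜 := ℂ) A := by
  obtain ⟨C, rfl⟩ := CStarAlgebra.nonneg_iff_eq_star_mul_self.mp hA.nonneg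
  rw [map_mul, map_star]
  exact star_mul_self_nonneg _

theorem inner_single_toEuclideanCLM {ι : Type*} [Fintype ι] [DecidableEq ι] (A : Matrix ι ι ℂ)
    (i j : ι) :
    ⟪EuclideanSpace.single i (1 : ℂ),
      toEuclideanCLM (n := ι) (𝕜 := ℂ) A (EuclideanSpace.single j 1)⟫_ℂ = A i j := by
  rw [EuclideanSpace.inner_single_left, ofLp_toEuclideanCLM]
  simp

/-- The compression of a complete contraction on `ℓ₁^N(ℓ_∞^K)`, placed in the upper right corner,
is a combination of four incomplete POVMs. -/
theorem exists_povm_polarization_of_completeContraction {H : Type} [NormedAddCommGroup H]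
    [InnerProductSpace ℂ H] {N : ℕ} {u : L1Linf N K →ₗ[ℂ] (H →L[ℂ] H)}
    (hu : IsCompleteContraction (l1LinfNorms N K) (opNorms H) u) {f : Fin n → H}
    (hf : Orthonormal ℂ f) :
    ∃ (c : Fin 4 → ℂ) (E : Fin 4 → Fin N → Fin K →
      (EuclideanSpace ℂ (Fin n ⊕ Fin n) →L[ℂ] EuclideanSpace ℂ (Fin n ⊕ Fin n))),
      (∀ k, ‖c k‖ = 1 / 2) ∧ (∀ k, IsIncompletePOVM (E k)) ∧
      ∀ x a, toEuclideanCLM (n := Fin n ⊕ Fin n) (𝕜 := ℂ)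
        (fromBlocks 0 (compression f (u (basisVec x a))) 0 0) = ∑ k, c k • E k x a := by
  have h (x : Fin N) := exists_povm_polarization (isTestContractive_compression
    (isCompleteContraction_comp_oneSumIncl (fun _ A => supNorms_nonneg A) hu x) hf)
  choose E hE1 hE2 hE3 using h
  refine ⟨fun k => (2 : ℂ)⁻¹ * star (Complex.I ^ (k : ℕ)),
    fun k x a => toEuclideanCLM (n := Fin n ⊕ Fin n) (𝕜 := ℂ) (E x k a), fun k => by simp,
    fun k => ⟨fun x a => toEuclideanCLM_nonneg (hE1 x k a), fun x => ?_⟩, fun x a => ?_⟩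
  · have h1 := toEuclideanCLM_nonneg (hE2 x k)
    rw [map_sub, map_one, map_sum, sub_nonneg] at h1
    exact h1
  · have h1 := hE3 x a
    simp only [mul_smul, ← Finset.smul_sum, ← map_smul, ← map_sum]
    rw [← h1]
    rfl

end Compression

/-! ### Sesquilinear forms as quadratic forms on doubled spaces -/

section Doubling

variable {n m : ℕ}

/-- The coefficients of the direct sum of two vectors on the doubled spaces. -/
def doubledCoeff (z w : Fin n → Fin m → ℂ) : Fin n ⊕ Fin n → Fin m ⊕ Fin m → ℂ
  | .inl i, .inl p => z i p
  | .inr i, .inr p => w i p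
  | _, _ => 0

/-- The standard orthonormal family of a Euclidean space. -/
abbrev stdVec (ι : Type*) [Fintype ι] [DecidableEq ι] (i : ι) : EuclideanSpace ℂ ι :=
  EuclideanSpace.single i 1

/-- Each corner sends the second copy to the first, so the quadratic form at `z ⊕ w` sees only `w`
on the right and `z` on the left. -/
theorem inner_doubled_tensorOp {H₁ H₂ : Type*} [NormedAddCommGroup H₁] [InnerProductSpace ℂ H₁]
    [NormedAddCommGroup H₂] [InnerProductSpace ℂ H₂] (f : Fin n → H₁) (g : Fin m → H₂)
    (z w : Fin n → Fin m → ℂ) (S : H₁ →L[ℂ] H₁) (T : H₂ →L[ℂ] H₂) :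
    ⟪coordVec (stdVec _) (stdVec _) (doubledCoeff z w),
      tensorOp (Matrix.toEuclideanCLM (n := Fin n ⊕ Fin n) (𝕜 := ℂ)
          (Matrix.fromBlocks 0 (compression f S) 0 0))
        (Matrix.toEuclideanCLM (n := Fin m ⊕ Fin m) (𝕜 := ℂ)
          (Matrix.fromBlocks 0 (compression g T) 0 0))
        (coordVec (stdVec _) (stdVec _) (doubledCoeff z w))⟫_ℂ =
    ⟪coordVec f g z, tensorOp S T (coordVec f g w)⟫_ℂ := by
  rw [inner_coordVec_tensorOp, inner_coordVec_tensorOp]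
  simp only [inner_single_toEuclideanCLM]
  simp [Fintype.sum_sum_type, doubledCoeff, compression]

theorem norm_sq_doubled (z w : Fin n → Fin m → ℂ) :
    ‖coordVec (stdVec (Fin n ⊕ Fin n)) (stdVec (Fin m ⊕ Fin m)) (doubledCoeff z w)‖ ^ 2 =
      ∑ i, ∑ p, ‖z i p‖ ^ 2 + ∑ i, ∑ p, ‖w i p‖ ^ 2 := by
  rw [norm_sq_coordVec EuclideanSpace.orthonormal_single EuclideanSpace.orthonormal_single]
  simp [Fintype.sum_sum_type, doubledCoeff]

end Doubling

/-! ### The bound of `bellMinNorm` by `quantumBound` -/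

section MinNormLe

variable {N K : ℕ}

theorem norm_inner_bellOp_coe_le (M : BellFunctional N K) {H₁ H₂ : Type}
    [NormedAddCommGroup H₁] [InnerProductSpace ℂ H₁]
    [NormedAddCommGroup H₂] [InnerProductSpace ℂ H₂]
    {u : L1Linf N K →ₗ[ℂ] (H₁ →L[ℂ] H₁)} {v : L1Linf N K →ₗ[ℂ] (H₂ →L[ℂ] H₂)}
    (hu : IsCompleteContraction (l1LinfNorms N K) (opNorms H₁) u)
    (hv : IsCompleteContraction (l1LinfNorms N K) (opNorms H₂) v) (ξ η : H₁ ⊗[ℂ] H₂) :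
    ‖⟪(ξ : HilbertTensor H₁ H₂),
      bellOp M (fun x a => u (basisVec x a)) (fun y b => v (basisVec y b)) η⟫_ℂ‖ ≤
      4 * quantumBound M *
        (‖(ξ : HilbertTensor H₁ H₂)‖ ^ 2 + ‖(η : HilbertTensor H₁ H₂)‖ ^ 2) := by
  obtain ⟨n, m, f, g, z, w, hf, hg, hξ, hη⟩ := exists_coordVec_pair ξ η
  obtain ⟨c, E, hc, hE, hEu⟩ := exists_povm_polarization_of_completeContraction hu hf
  obtain ⟨d, F, hd, hF, hFv⟩ := exists_povm_polarization_of_completeContraction hv hg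
  rw [hξ, hη]
  set ζ := coordVec (stdVec (Fin n ⊕ Fin n)) (stdVec (Fin m ⊕ Fin m)) (doubledCoeff z w)
  have hζ : ‖ζ‖ ^ 2 = ‖coordVec f g z‖ ^ 2 + ‖coordVec f g w‖ ^ 2 := by
    rw [norm_sq_coordVec hf hg, norm_sq_coordVec hf hg]
    exact norm_sq_doubled z w
  have h1 : ⟪coordVec f g z, bellOp M (fun x a => u (basisVec x a))
      (fun y b => v (basisVec y b)) (coordVec f g w)⟫_ℂ =
      ∑ k, ∑ l, c k * d l * ⟪ζ, bellOp M (E k) (F l) ζ⟫_ℂ := by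
    have h2 : ⟪coordVec f g z, bellOp M (fun x a => u (basisVec x a))
        (fun y b => v (basisVec y b)) (coordVec f g w)⟫_ℂ =
        ⟪ζ, bellOp M (fun x a => ∑ k, c k • E k x a) (fun y b => ∑ l, d l • F l y b) ζ⟫_ℂ := by
      simp only [inner_bellOp, ← hEu, ← hFv, ζ, inner_doubled_tensorOp]
    rw [h2, bellOp_sum_smul_left]
    simp only [bellOp_sum_smul_right, sum_apply, smul_apply, inner_sum, inner_smul_right,
      Finset.mul_sum, mul_assoc]
  rw [h1, ← hζ]
  -- Sixteen pairs of POVMs, each of weight 1/4, account for the factor 4.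
  calc _ ≤ ∑ k : Fin 4, ∑ l : Fin 4, 1 / 2 * (1 / 2) * (quantumBound M * ‖ζ‖ ^ 2) := by
        refine (norm_sum_le _ _).trans (Finset.sum_le_sum fun k _ => ?_)
        refine (norm_sum_le _ _).trans (Finset.sum_le_sum fun l _ => ?_)
        rw [norm_mul, norm_mul, hc, hd]
        exact mul_le_mul_of_nonneg_left (norm_inner_bellOp_le M (hE k) (hF l) ζ) (by norm_num)
    _ = 4 * quantumBound M * ‖ζ‖ ^ 2 := by
        simp
        ring

/-- Normalising `x` and `y` separately turns the sum of squares into 2. -/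
theorem opNorm_le_of_norm_inner_le_add {E : Type*} [NormedAddCommGroup E]
    [InnerProductSpace ℂ E] {T : E →L[ℂ] E} {C : ℝ} (hC : 0 ≤ C)
    (h : ∀ x y, ‖⟪x, T y⟫_ℂ‖ ≤ C * (‖x‖ ^ 2 + ‖y‖ ^ 2)) : ‖T‖ ≤ 2 * C := by
  refine opNorm_le_of_norm_inner_le (by positivity) fun x y => ?_
  rcases eq_or_ne x 0 with rfl | hx
  · simp
  rcases eq_or_ne y 0 with rfl | hy
  · simp
  have h1 := h ((‖x‖ : ℂ)⁻¹ • x) ((‖y‖ : ℂ)⁻¹ • y)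
  have hx' : ‖(‖x‖ : ℂ)⁻¹ • x‖ = 1 := norm_smul_inv_norm hx
  have hy' : ‖(‖y‖ : ℂ)⁻¹ • y‖ = 1 := norm_smul_inv_norm hy
  have hxp : 0 < ‖x‖ := norm_pos_iff.2 hx
  have hyp : 0 < ‖y‖ := norm_pos_iff.2 hy
  rw [hx', hy', map_smul, inner_smul_left, inner_smul_right, norm_mul, norm_mul,
    RCLike.norm_conj, norm_inv, norm_inv, Complex.norm_real, Complex.norm_real, norm_norm,
    norm_norm] at h1
  have e : ‖⟪x, T y⟫_ℂ‖ = ‖x‖ * ‖y‖ * (‖x‖⁻¹ * (‖y‖⁻¹ * ‖⟪x, T y⟫_ℂ‖)) := by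
    field_simp
  rw [e]
  nlinarith [mul_le_mul_of_nonneg_left h1 (mul_pos hxp hyp).le]

theorem bellMinNorm_le (M : BellFunctional N K) : bellMinNorm M ≤ 8 * quantumBound M := by
  have hB := quantumBound_nonneg M
  refine Real.sSup_le ?_ (by positivity)
  rintro r ⟨H₁, _, _, _, H₂, _, _, _, u, v, hu, hv, rfl⟩
  rw [tensorOpLin_map_bellTensor]
  refine (opNorm_le_of_norm_inner_le_add (C := 4 * quantumBound M) (by positivity)
    fun x y => ?_).trans (by linarith)
  induction x, y using UniformSpace.Completion.induction_on₂ with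
  | hp => exact isClosed_le (by fun_prop) (by fun_prop)
  | ih ξ η => exact norm_inner_bellOp_coe_le M hu hv ξ η

end MinNormLe

/-! ### Comparison of the injective norm with the classical bound -/

section Epsilon

variable {N K : ℕ}

/-- The value `∑ M_{x,y}^{a,b} p(x,a) q(y,b)` of a product strategy. -/
def productValue (M : BellFunctional N K) (p q : Fin N → Fin K → ℂ) : ℂ :=
  ∑ x, ∑ y, ∑ a, ∑ b, M x y a b • (p x a * q y b)

theorem productValue_sum_left {κ : Type*} [Fintype κ] (M : BellFunctional N K) (c : κ → ℂ)
    (p : κ → Fin N → Fin K → ℂ) (q : Fin N → Fin K → ℂ) :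
    productValue M (fun x a => ∑ k, c k * p k x a) q = ∑ k, c k * productValue M (p k) q := by
  simp only [productValue, Finset.sum_mul, mul_assoc]
  exact sum_smul_sum_smul_comm M c fun k x y a b => p k x a * q y b

theorem productValue_sum_right {κ : Type*} [Fintype κ] (M : BellFunctional N K) (c : κ → ℂ)
    (p : Fin N → Fin K → ℂ) (q : κ → Fin N → Fin K → ℂ) :
    productValue M p (fun y b => ∑ k, c k * q k y b) = ∑ k, c k * productValue M p (q k) := by
  simp only [productValue, Finset.mul_sum (s := (Finset.univ : Finset κ)), mul_left_comm (p _ _)]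
  exact sum_smul_sum_smul_comm M c fun k x y a b => p x a * q k y b

theorem lid_map_bellTensor (M : BellFunctional N K) (φ ψ : L1Linf N K →L[ℂ] ℂ) :
    TensorProduct.lid ℂ ℂ (TensorProduct.map φ.toLinearMap ψ.toLinearMap (bellTensor M)) =
      productValue M (fun x a => φ (basisVec x a)) (fun y b => ψ (basisVec y b)) := by
  simp only [bellTensor, map_sum, map_smul, TensorProduct.map_tmul, TensorProduct.lid_tmul,
    productValue, smul_eq_mul]
  rfl

/-- The linear functional on `ℓ₁^N(ℓ_∞^K)` with coefficients `p`. -/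
def coeffLinear (p : Fin N → Fin K → ℂ) : L1Linf N K →ₗ[ℂ] ℂ where
  toFun e := ∑ x, ∑ a, e x a * p x a
  map_add' e f := by
    simp only [WithLp.ofLp_add, Pi.add_apply, add_mul, Finset.sum_add_distrib]
  map_smul' c e := by
    simp only [WithLp.ofLp_smul, Pi.smul_apply, smul_eq_mul, mul_assoc, Finset.mul_sum,
      RingHom.id_apply]

theorem norm_coeffLinear_le (p : Fin N → Fin K → ℂ) (hp : ∀ x, ∑ a, ‖p x a‖ ≤ 1)
    (e : L1Linf N K) : ‖coeffLinear p e‖ ≤ 1 * ‖e‖ := by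
  rw [one_mul, PiLp.norm_eq_of_L1]
  change ‖∑ x, ∑ a, e x a * p x a‖ ≤ _
  refine (norm_sum_le _ _).trans (Finset.sum_le_sum fun x _ => ?_)
  calc ‖∑ a, e x a * p x a‖ ≤ ∑ a, ‖e x‖ * ‖p x a‖ := by
        refine (norm_sum_le _ _).trans (Finset.sum_le_sum fun a _ => ?_)
        rw [norm_mul]
        exact mul_le_mul_of_nonneg_right (norm_le_pi_norm (e x) a) (norm_nonneg _)
    _ = ‖e x‖ * ∑ a, ‖p x a‖ := by rw [Finset.mul_sum]
    _ ≤ ‖e x‖ := mul_le_of_le_one_right (norm_nonneg _) (hp x)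

/-- The contractive functional on `ℓ₁^N(ℓ_∞^K)` with coefficients `p`. -/
def coeffFunctional (p : Fin N → Fin K → ℂ) (hp : ∀ x, ∑ a, ‖p x a‖ ≤ 1) :
    L1Linf N K →L[ℂ] ℂ :=
  (coeffLinear p).mkContinuous 1 (norm_coeffLinear_le p hp)

theorem norm_coeffFunctional_le (p : Fin N → Fin K → ℂ) (hp : ∀ x, ∑ a, ‖p x a‖ ≤ 1) :
    ‖coeffFunctional p hp‖ ≤ 1 :=
  LinearMap.mkContinuous_norm_le _ zero_le_one _

theorem coeffFunctional_basisVec (p : Fin N → Fin K → ℂ) (hp : ∀ x, ∑ a, ‖p x a‖ ≤ 1)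
    (x : Fin N) (a : Fin K) : coeffFunctional p hp (basisVec x a) = p x a := by
  change ∑ x', ∑ a', (basisVec x a : L1Linf N K) x' a' * p x' a' = p x a
  rw [Finset.sum_eq_single x, Finset.sum_eq_single a]
  · simp [basisVec]
  · intro a' _ ha
    simp [basisVec, ha]
  · simp
  · intro x' _ hx
    simp [basisVec, hx]
  · simp

/-- Evaluation of `φ` at the unit-ball vector whose `x`-th component carries the phases that make
every `φ (basisVec x a)` nonnegative. -/
theorem sum_norm_apply_basisVec_le {φ : L1Linf N K →L[ℂ] ℂ} (hφ : ‖φ‖ ≤ 1) (x : Fin N) :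
    ∑ a, ‖φ (basisVec x a)‖ ≤ 1 := by
  have hph (w : ℂ) : ∃ s : ℂ, ‖s‖ ≤ 1 ∧ s * w = ‖w‖ := by
    rcases eq_or_ne w 0 with rfl | hw
    · exact ⟨0, by simp, by simp⟩
    · refine ⟨‖w‖ / w, ?_, div_mul_cancel₀ _ hw⟩
      rw [norm_div, Complex.norm_real, norm_norm, div_self (norm_ne_zero_iff.2 hw)]
  choose s hs1 hs2 using hph
  set t : Fin K → ℂ := fun a => s (φ (basisVec x a))
  have ht : ‖t‖ ≤ 1 := (pi_norm_le_iff_of_nonneg zero_le_one).2 fun a => hs1 _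
  have he : (WithLp.toLp 1 (Pi.single x t) : L1Linf N K) = ∑ a, t a • basisVec x a := by
    have h1 : t = ∑ a, t a • (Pi.single a 1 : Fin K → ℂ) := by
      ext a
      simp [Finset.sum_apply, Pi.single_apply]
    change oneSumIncl x t = _
    conv_lhs => rw [h1, map_sum]
    simp only [map_smul]
    rfl
  have hnorm : ‖(WithLp.toLp 1 (Pi.single x t) : L1Linf N K)‖ ≤ 1 := by
    rw [PiLp.norm_eq_of_L1, Finset.sum_eq_single x]
    · simpa using ht
    · intro x' _ hx
      simp [hx]
    · simp
  have h := φ.le_of_opNorm_le hφ (WithLp.toLp 1 (Pi.single x t))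
  rw [he, map_sum] at h
  simp only [map_smul, smul_eq_mul, t, hs2, ← Complex.ofReal_sum] at h
  rw [Complex.norm_real, Real.norm_of_nonneg (by positivity)] at h
  refine h.trans ?_
  rw [one_mul]
  rw [he] at hnorm
  exact hnorm

theorem norm_productValue_le (M : BellFunctional N K) {p q : Fin N → Fin K → ℂ}
    (hp : ∀ x, ∑ a, ‖p x a‖ ≤ 1) (hq : ∀ y, ∑ b, ‖q y b‖ ≤ 1) :
    ‖productValue M p q‖ ≤ ∑ x, ∑ y, ∑ a, ∑ b, ‖M x y a b‖ * 1 := by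
  refine norm_sum_smul_le M (c := fun _ _ => 1) fun x y a b => ?_
  have h1 : ‖p x a‖ ≤ 1 := (Finset.single_le_sum (f := fun a => ‖p x a‖)
    (fun _ _ => norm_nonneg _) (Finset.mem_univ a)).trans (hp x)
  have h2 : ‖q y b‖ ≤ 1 := (Finset.single_le_sum (f := fun b => ‖q y b‖)
    (fun _ _ => norm_nonneg _) (Finset.mem_univ b)).trans (hq y)
  rw [norm_mul]
  exact mul_le_one₀ h1 (norm_nonneg _) h2

theorem norm_productValue_le_bellEpsNorm (M : BellFunctional N K) {p q : Fin N → Fin K → ℂ}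
    (hp : ∀ x, ∑ a, ‖p x a‖ ≤ 1) (hq : ∀ y, ∑ b, ‖q y b‖ ≤ 1) :
    ‖productValue M p q‖ ≤ bellEpsNorm M := by
  refine le_csSup ⟨∑ x, ∑ y, ∑ a, ∑ b, ‖M x y a b‖ * 1, ?_⟩
    ⟨coeffFunctional p hp, coeffFunctional q hq, norm_coeffFunctional_le p hp,
      norm_coeffFunctional_le q hq, ?_⟩
  · rintro r ⟨φ, ψ, hφ, hψ, rfl⟩
    rw [lid_map_bellTensor]
    exact norm_productValue_le M (sum_norm_apply_basisVec_le hφ) (sum_norm_apply_basisVec_le hψ)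
  · rw [lid_map_bellTensor]
    simp only [coeffFunctional_basisVec]

theorem bellEpsNorm_nonneg (M : BellFunctional N K) : 0 ≤ bellEpsNorm M := by
  refine Real.sSup_nonneg ?_
  rintro r ⟨φ, ψ, hφ, hψ, rfl⟩
  exact norm_nonneg _

/-- The pairing is the average over `ω` of product values, each bounded by the injective norm. -/
theorem norm_pairing_le_bellEpsNorm (M : BellFunctional N K) {P : Behaviour N K}
    (hP : IsIncompleteClassical P) : ‖pairing M P‖ ≤ bellEpsNorm M := by
  obtain ⟨Ω, _, μ, p, q, hμ, hpm, hqm, hp0, hp1, hq0, hq1, hP⟩ := hP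
  have hple (ω x a) : p ω x a ≤ 1 := (Finset.single_le_sum (f := fun a => p ω x a)
    (fun a _ => hp0 ω x a) (Finset.mem_univ a)).trans (hp1 ω x)
  have hqle (ω x a) : q ω x a ≤ 1 := (Finset.single_le_sum (f := fun a => q ω x a)
    (fun a _ => hq0 ω x a) (Finset.mem_univ a)).trans (hq1 ω x)
  have hint (x y a b) :
      MeasureTheory.Integrable (fun ω => M x y a b • ((p ω x a : ℂ) * (q ω y b : ℂ))) μ := by
    have h1 : MeasureTheory.Integrable (fun ω => (p ω x a : ℂ) * (q ω y b : ℂ)) μ := by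
      refine MeasureTheory.Integrable.of_bound ?_ 1 (Filter.Eventually.of_forall fun ω => ?_)
      · exact ((Complex.measurable_ofReal.comp (hpm x a)).mul
          (Complex.measurable_ofReal.comp (hqm y b))).aestronglyMeasurable
      · rw [norm_mul, Complex.norm_real, Complex.norm_real, Real.norm_of_nonneg (hp0 ω x a),
          Real.norm_of_nonneg (hq0 ω y b)]
        exact mul_le_one₀ (hple ω x a) (hq0 ω y b) (hqle ω y b)
    exact h1.smul (M x y a b)
  have h : pairing M P =
      ∫ ω, productValue M (fun x a => (p ω x a : ℂ)) (fun y b => (q ω y b : ℂ)) ∂μ := by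
    have h4 (x y a b) : M x y a b * (P x y a b : ℂ) =
        ∫ ω, M x y a b • ((p ω x a : ℂ) * (q ω y b : ℂ)) ∂μ := by
      rw [MeasureTheory.integral_smul, hP, smul_eq_mul, ← integral_complex_ofReal]
      simp only [Complex.ofReal_mul]
    simp only [pairing, productValue, h4]
    rw [MeasureTheory.integral_finsetSum]
    swap
    · exact fun x _ => MeasureTheory.integrable_finsetSum _ fun y _ =>
        MeasureTheory.integrable_finsetSum _ fun a _ =>
          MeasureTheory.integrable_finsetSum _ fun b _ => hint x y a b
    refine Finset.sum_congr rfl fun x _ => ?_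
    rw [MeasureTheory.integral_finsetSum]
    swap
    · exact fun y _ => MeasureTheory.integrable_finsetSum _ fun a _ =>
          MeasureTheory.integrable_finsetSum _ fun b _ => hint x y a b
    refine Finset.sum_congr rfl fun y _ => ?_
    rw [MeasureTheory.integral_finsetSum]
    swap
    · exact fun a _ => MeasureTheory.integrable_finsetSum _ fun b _ => hint x y a b
    refine Finset.sum_congr rfl fun a _ => ?_
    rw [MeasureTheory.integral_finsetSum _ fun b _ => hint x y a b]
  rw [h]
  refine (MeasureTheory.norm_integral_le_of_norm_le_const (C := bellEpsNorm M)
    (Filter.Eventually.of_forall fun ω => ?_)).trans (by simp)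
  refine norm_productValue_le_bellEpsNorm M (fun x => ?_) (fun y => ?_)
  · simpa only [Complex.norm_real, Real.norm_of_nonneg (hp0 ω x _)] using hp1 ω x
  · simpa only [Complex.norm_real, Real.norm_of_nonneg (hq0 ω y _)] using hq1 ω y

theorem classicalBound_le_bellEpsNorm (M : BellFunctional N K) :
    classicalBound M ≤ bellEpsNorm M := by
  refine Real.sSup_le ?_ (bellEpsNorm_nonneg M)
  rintro r ⟨P, hP, rfl⟩
  exact norm_pairing_le_bellEpsNorm M hP

theorem norm_productValue_ofReal_le (M : BellFunctional N K) {p q : Fin N → Fin K → ℝ}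
    (hp0 : ∀ x a, 0 ≤ p x a) (hp1 : ∀ x, ∑ a, p x a ≤ 1)
    (hq0 : ∀ y b, 0 ≤ q y b) (hq1 : ∀ y, ∑ b, q y b ≤ 1) :
    ‖productValue M (fun x a => (p x a : ℂ)) (fun y b => (q y b : ℂ))‖ ≤ classicalBound M := by
  refine le_csSup ⟨bellEpsNorm M, ?_⟩ ⟨fun x y a b => p x a * q y b, ?_, ?_⟩
  · rintro r ⟨P, hP, rfl⟩
    exact norm_pairing_le_bellEpsNorm M hP
  · exact ⟨Unit, inferInstance, MeasureTheory.Measure.dirac (), fun _ => p, fun _ => q,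
      inferInstance, fun _ _ => measurable_const, fun _ _ => measurable_const, fun _ => hp0,
      fun _ => hp1, fun _ => hq0, fun _ => hq1, fun x y a b => by simp⟩
  · simp only [pairing, productValue, Complex.ofReal_mul, smul_eq_mul]

/-- The four nonnegative parts of a complex number. -/
def nonnegPart (w : ℂ) (k : Fin 4) : ℝ := max (star (Complex.I ^ (k : ℕ)) * w).re 0

theorem nonnegPart_le_norm (w : ℂ) (k : Fin 4) : nonnegPart w k ≤ ‖w‖ := by
  refine max_le ((Complex.re_le_norm _).trans ?_) (norm_nonneg _)
  simp

theorem sum_nonnegPart (w : ℂ) :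
    w = ∑ k : Fin 4, Complex.I ^ (k : ℕ) * (nonnegPart w k : ℂ) := by
  have hI3 : Complex.I ^ 3 = -Complex.I := by rw [pow_succ, Complex.I_sq]; ring
  have hmax (r : ℝ) : max r 0 - max (-r) 0 = r := by
    rcases le_total 0 r with h | h
    · rw [max_eq_left h, max_eq_right (by linarith), sub_zero]
    · rw [max_eq_right h, max_eq_left (by linarith)]; ring
  simp only [Fin.sum_univ_four, nonnegPart, Fin.coe_ofNat_eq_mod, Nat.reduceMod, pow_zero,
    pow_one, Complex.I_sq, hI3]
  apply Complex.ext
  · simpa [sub_eq_add_neg] using (hmax w.re).symm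
  · simpa [sub_eq_add_neg] using (hmax w.im).symm

theorem classicalBound_nonneg (M : BellFunctional N K) : 0 ≤ classicalBound M := by
  refine Real.sSup_nonneg ?_
  rintro r ⟨P, hP, rfl⟩
  exact norm_nonneg _

/-- Nonnegative parts are dominated by the modulus, hence remain subnormalised; four parts for each
party give 16 classical product strategies. -/
theorem norm_productValue_le_classicalBound (M : BellFunctional N K)
    {p q : Fin N → Fin K → ℂ} (hp : ∀ x, ∑ a, ‖p x a‖ ≤ 1) (hq : ∀ y, ∑ b, ‖q y b‖ ≤ 1) :
    ‖productValue M p q‖ ≤ 16 * classicalBound M := by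
  have hpart {p : Fin N → Fin K → ℂ} (hp : ∀ x, ∑ a, ‖p x a‖ ≤ 1) (k : Fin 4) (x : Fin N) :
      ∑ a, nonnegPart (p x a) k ≤ 1 :=
    (Finset.sum_le_sum fun a _ => nonnegPart_le_norm (p x a) k).trans (hp x)
  have hexp : productValue M p q = ∑ k : Fin 4, Complex.I ^ (k : ℕ) * ∑ l : Fin 4,
      Complex.I ^ (l : ℕ) * productValue M (fun x a => (nonnegPart (p x a) k : ℂ))
        (fun y b => (nonnegPart (q y b) l : ℂ)) := by
    simp only [← productValue_sum_right, ← sum_nonnegPart]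
    rw [← productValue_sum_left]
    simp only [← sum_nonnegPart]
  rw [hexp]
  calc _ ≤ ∑ k : Fin 4, ∑ l : Fin 4, classicalBound M := by
        refine (norm_sum_le _ _).trans (Finset.sum_le_sum fun k _ => ?_)
        rw [norm_mul, norm_pow, Complex.norm_I, one_pow, one_mul]
        refine (norm_sum_le _ _).trans (Finset.sum_le_sum fun l _ => ?_)
        rw [norm_mul, norm_pow, Complex.norm_I, one_pow, one_mul]
        exact norm_productValue_ofReal_le M (fun _ _ => le_max_right _ _) (hpart hp k)
          (fun _ _ => le_max_right _ _) (hpart hq l)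
    _ = 16 * classicalBound M := by
        simp
        ring

theorem bellEpsNorm_le (M : BellFunctional N K) :
    bellEpsNorm M ≤ 16 * classicalBound M := by
  refine Real.sSup_le ?_ (mul_nonneg (by norm_num) (classicalBound_nonneg M))
  rintro r ⟨φ, ψ, hφ, hψ, rfl⟩
  rw [lid_map_bellTensor]
  exact norm_productValue_le_classicalBound M (sum_norm_apply_basisVec_le hφ)
    (sum_norm_apply_basisVec_le hψ)

end Epsilon

end

end BellMin

theorem mainTheorem6 :
    (∀ (N K : ℕ) (M : BellMin.BellFunctional N K),
      BellMin.quantumBound M ≤ BellMin.bellMinNorm M ∧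
      BellMin.bellMinNorm M ≤ 16 * BellMin.quantumBound M) ∧
    ∃ c C : ℝ, 0 < c ∧ 0 < C ∧
      ∀ (N K : ℕ) (M : BellMin.BellFunctional N K), BellMin.classicalBound M ≠ 0 →
        c * (BellMin.bellMinNorm M / BellMin.bellEpsNorm M) ≤ BellMin.largestViolation M ∧
        BellMin.largestViolation M ≤ C * (BellMin.bellMinNorm M / BellMin.bellEpsNorm M) := by
  refine ⟨fun N K M => ⟨BellMin.quantumBound_le_bellMinNorm M, ?_⟩,
    -- `1 / 8` combines `‖M‖_min ≤ 8 B_Q` with `B_C ≤ ‖M‖_ε`; `16` combines `B_Q ≤ ‖M‖_min` with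
    -- `‖M‖_ε ≤ 16 B_C`.
    1 / 8, 16, by norm_num, by norm_num, fun N K M hC => ?_⟩
  · linarith [BellMin.bellMinNorm_le M, BellMin.quantumBound_nonneg M]
  · have hC' : 0 < BellMin.classicalBound M := (BellMin.classicalBound_nonneg M).lt_of_ne' hC
    have h1 := BellMin.classicalBound_le_bellEpsNorm M
    have h2 := BellMin.bellEpsNorm_le M
    have h3 := BellMin.quantumBound_le_bellMinNorm M
    have h4 := BellMin.bellMinNorm_le M
    have h5 := BellMin.quantumBound_nonneg M
    have hE : 0 < BellMin.bellEpsNorm M := hC'.trans_le h1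
    rw [BellMin.largestViolation]
    constructor
    · calc 1 / 8 * (BellMin.bellMinNorm M / BellMin.bellEpsNorm M)
          ≤ 1 / 8 * (8 * BellMin.quantumBound M / BellMin.classicalBound M) := by gcongr
        _ = BellMin.quantumBound M / BellMin.classicalBound M := by ring
    · calc BellMin.quantumBound M / BellMin.classicalBound M
          = 16 * (BellMin.quantumBound M / (16 * BellMin.classicalBound M)) := by
            field_simp
        _ ≤ 16 * (BellMin.bellMinNorm M / BellMin.bellEpsNorm M) := by
            gcongr
            exact h5.trans h3
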